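/- Let $\mathfrak U=\langle S;P_1,\dots,P_r;L_1,\dots,L_r\rangle$, where $S\subseteq\mathbb R_+$ is countable, $P_1,\dots,P_r$ ($r\ge 0$) are relation symbols of arities $k_1,\dots,k_r\ge 1$, and $L_i$ is a subgroup of the symmetric group $\mathrm{Sym}(k_i)$. Let $L_{\mathfrak U}=\{E_s: s\in S\}\cup\{P_1,\dots,P_r\}$ with each $E_s$ a binary relation symbol. An $L_{\mathfrak U}$-structure $X$ is a *$\mathfrak U$-structure* if (1) each $P_i^X$ is invariant under permutations of its arguments by elements of $L_i$; (2) if $P_i^X(x_1,\dots,x_{k_i})$, then $x_1,\dots,x_{k_i}$ are distinct; (3) each $E_s^X$ is an equivalence relation; (4) $E_s^X\subseteq E_t^X$ whenever $s<t$ in $S$; (5) if $S\neq\emptyset$, then for all $x\neq y$ in $X$ there is a largest $s\in S$ such that $(x,y)\notin E_s^X$. Let $\mathbf U$ be the randomised ultrametric space corresponding to $\mathfrak U$, that is, the Fraïssé limit of the class of finite $\mathfrak U$-structures: the countable ultrahomogeneous structure, unique up to isomorphism, whose finite substructures are, up to isomorphism, exactly the finite $\mathfrak U$-structures. Give $\mathrm{Aut}(\mathbf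 U)$ the topology of pointwise convergence, with $\mathbf U$ discrete. A *commuting $n$-tuple* is an element of $$\{(g_1,\dots,g_n)\in \mathrm{Aut}(\mathbf U)^n : g_ig_j=g_jg_i \text{ for all } i,j\},$$ and this set carries the subspace topology of $\mathrm{Aut}(\mathbf U)^n$. A commuting $n$-tuple is *generic* if its orbit under diagonal conjugation by $\mathrm{Aut}(\mathbf U)$ is comeagre in this space. Then for every $n\ge 0$ there is a generic commuting $n$-tuple in $\mathrm{Aut}(\mathbf U)$. Moreover, for every generic commuting $n$-tuple $(g_1,\dots,g_n)$, with commutant $$C(g_1,\dots,g_n)=\{h\in\mathrm{Aut}(\mathbf U): hg_i=g_ih \text{ for all } i\}$$ in the subspace topology, the set of all $h\in C(g_1,\dots,g_n)$ such that $(g_1,\dots,g_n,h)$ is a generic commuting $(n+1)$-tuple is comeagre in $C(g_1,\dots,g_n)$. In particular, the group $C(g_1,\dots,g_n)$ has a comeagre conjugacy class. -/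

import Mathlib

open scoped FirstOrder

/-! ### Automorphism groups of first-order structures -/

section Aut

variable {L : FirstOrder.Language} {M : Type*} [L.Structure M]

/-- The group of automorphisms of a structure: `f * g` is the composition `f ∘ g`. -/
instance autGroup : Group (M ≃[L] M) where
  mul f g := f.comp g
  one := FirstOrder.Language.Equiv.refl L M
  inv f := f.symm
  mul_assoc _ _ _ := rfl
  one_mul _ := rfl
  mul_one _ := rfl
  inv_mul_cancel f := FirstOrder.Language.Equiv.ext fun x => f.symm_apply_apply x

/-- The topology of pointwise convergence on the automorphism group, the structure itself being
taken discrete. -/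
instance autTopology : TopologicalSpace (M ≃[L] M) :=
  TopologicalSpace.induced (fun f : M ≃[L] M => (f : M → M))
    (@Pi.topologicalSpace M (fun _ => M) (fun _ => ⊥))

end Aut

/-! ### Generic commuting tuples -/

section Tuples

variable {G : Type*} [Group G]

/-- The set of commuting `n`-tuples in `G`, that is, of representations of `ℤⁿ` in `G`. It gets
the subspace topology from the product `Gⁿ`. -/
def commutingTuples (n : ℕ) (G : Type*) [Group G] : Set (Fin n → G) :=
  {g | ∀ i j, g i * g j = g j * g i}

/-- The orbit of a tuple `g` under diagonal conjugation. -/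
def diagonalClass {n : ℕ} (g : Fin n → G) : Set (Fin n → G) :=
  {h | ∃ k : G, ∀ i, h i = k * g i * k⁻¹}

/-- A commuting tuple is generic if its orbit under diagonal conjugation is comeagre in the space
of commuting tuples. -/
def IsGenericCommutingTuple [TopologicalSpace G] {n : ℕ} (g : Fin n → G) : Prop :=
  g ∈ commutingTuples n G ∧
    {h : commutingTuples n G | (h : Fin n → G) ∈ diagonalClass g} ∈
      residual (commutingTuples n G)

/-- The commutant `C(g₁, …, gₙ)`. As a subset of `G` it gets the subspace topology. -/
abbrev commutant {n : ℕ} (g : Fin n → G) : Subgroup G :=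
  Subgroup.centralizer (Set.range g)

end Tuples

/-! ### Randomised ultrametric spaces -/

/-- The data `⟨S; P₁, …, Pᵣ; L₁, …, Lᵣ⟩`: a countable set `S` of distances, finitely many relation
symbols with their arities, and for each of them a group of symmetries. -/
structure RandomisedUltrametricData where
  /-- the distances -/
  S : Set ℝ
  S_countable : S.Countable
  S_nonneg : ∀ s ∈ S, 0 ≤ s
  /-- the number of relation symbols -/
  r : ℕ
  /-- the arities -/
  arity : Fin r → ℕ
  arity_pos : ∀ i, 0 < arity i
  /-- the symmetry groups -/
  sym : (i : Fin r) → Subgroup (Equiv.Perm (Fin (arity i)))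

namespace RandomisedUltrametricData

variable (D : RandomisedUltrametricData)

/-- The relation symbols: a binary symbol `E s` for each `s ∈ S`, and the symbols `P i`. -/
inductive Rel : ℕ → Type
  | E (s : D.S) : Rel 2
  | P (i : Fin D.r) : Rel (D.arity i)

/-- The relational language with symbols `E s`, `s ∈ S`, and `P i`. -/
def language : FirstOrder.Language.{0, 0} where
  Functions := fun _ => Empty
  Relations := D.Rel

instance (n : ℕ) : IsEmpty (D.language.Functions n) :=
  inferInstanceAs (IsEmpty Empty)

instance : Countable (Σ n, D.language.Functions n) :=
  inferInstance

variable (X : Type*) [D.language.Structure X]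

/-- The interpretation of `E s`. -/
def relE {X : Type*} [D.language.Structure X] (s : D.S) (x y : X) : Prop :=
  FirstOrder.Language.Structure.RelMap (L := D.language) (Rel.E s : D.Rel 2) ![x, y]

/-- The interpretation of `P i`. -/
def relP {X : Type*} [D.language.Structure X] (i : Fin D.r) (x : Fin (D.arity i) → X) : Prop :=
  FirstOrder.Language.Structure.RelMap (L := D.language) (Rel.P i : D.Rel (D.arity i)) x

/-- The structures attached to the data. If `S` is empty there is no ultrametric part, and the
last condition is void. -/
structure IsUStructure : Prop where
  symmetric : ∀ i, ∀ σ ∈ D.sym i, ∀ x : Fin (D.arity i) → X, D.relP i (x ∘ σ) ↔ D.relP i x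
  distinct : ∀ i, ∀ x : Fin (D.arity i) → X, D.relP i x → Function.Injective x
  equivalence : ∀ s, Equivalence (D.relE s (X := X))
  nested : ∀ s t : D.S, s < t → ∀ x y : X, D.relE s x y → D.relE t x y
  exists_max : D.S.Nonempty → ∀ x y : X, x ≠ y → ∃ s, IsGreatest {s : D.S | ¬ D.relE s x y} s

/-- The class of all finite structures attached to the data. -/
def finiteUStructures : Set (CategoryTheory.Bundled D.language.Structure) :=
  {X | Finite X ∧ D.IsUStructure X}

/-- `U` is the randomised ultrametric space of the data: the Fraïssé limit of the class of finite
structures attached to the data, i.e. the countable ultrahomogeneous structure whose age is this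
class. It is unique up to isomorphism. -/
def IsRandomisedUltrametricSpace (U : Type*) [Countable U] [D.language.Structure U] : Prop :=
  FirstOrder.Language.IsFraisseLimit D.finiteUStructures U

end RandomisedUltrametricData

/-! ### The topology of automorphism groups -/

section Topology

open Set Topology

/-! Genericity turns out to be the combinatorial property `IsUniversalTuple`: the tuple commutes, is
locally finite, and realises every finite extension of its finite pieces that occurs in some
commuting tuple. Two universal tuples are conjugate by back-and-forth, and universality is a
countable intersection of open conditions. These conditions are dense once (a) commuting tuples can
be approximated by ones with finite invariant sets and (b) finite pieces amalgamate. Baire category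
then gives existence and the equivalence `isGenericCommutingTuple_iff`.

For a universal tuple g the same conditions on (g, h) are dense as h runs over the commutant. By the
extension property, a finite piece of a commuting (n+1)-tuple lying over a piece of g can be moved
into g. Its last entry then commutes with g on a finite invariant set, and back-and-forth between g
and itself extends it to the commutant (`IsUniversalTuple.exists_commutant`).

For the structure itself, `E s` is read as "distance less than s". Property (b) follows from free
amalgamation of ultrametric structures, once finite partial commuting tuples are known to extend to
commuting automorphisms; that extension adds permuted copies of the new points. For (a), let Γ be
the finitely generated abelian group generated by the tuple. Subgroups of such groups are separable,
so for suitable m passing to Γ^m-orbits distorts nothing on a given finite set. Since Γ/Γ^m is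
finite, the Γ-saturation of the image of that set is a finite structure with commuting automorphisms
(`exists_finite_quotient`), and it embeds back into U. -/

theorem Topology.IsInducing.isOpen_iff_agree {Y J M : Type*} [TopologicalSpace Y]
    [TopologicalSpace M] [DiscreteTopology M] {e : Y → J → M} (he : IsInducing e) {V : Set Y} :
    IsOpen V ↔ ∀ y ∈ V, ∃ F : Set J, F.Finite ∧ ∀ y', (∀ j ∈ F, e y' j = e y j) → y' ∈ V := by
  constructor
  · intro hV y hy
    obtain ⟨W, hW, rfl⟩ := he.isOpen_iff.1 hV
    obtain ⟨F, u, hu, hsub⟩ := isOpen_pi_iff.1 hW (e y) hy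
    refine ⟨F, F.finite_toSet, fun y' h => hsub fun j hj => ?_⟩
    rw [h j hj]
    exact (hu j hj).2
  · intro h
    refine isOpen_iff_forall_mem_open.2 fun y hy => ?_
    obtain ⟨F, hF, hV⟩ := h y hy
    refine ⟨e ⁻¹' F.pi fun j => {e y j}, fun y' hy' => hV y' fun j hj => hy' j hj, ?_, ?_⟩
    · exact (isOpen_set_pi hF fun _ _ => isOpen_discrete _).preimage he.continuous
    · exact fun j _ => rfl

theorem isClosed_setOf_forall {X : Type*} [TopologicalSpace X] {ι : Sort*} {p : ι → X → Prop}
    (h : ∀ i, IsClosed {x | p i x}) : IsClosed {x | ∀ i, p i x} := by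
  rw [ofPred_forall]
  exact isClosed_iInter h

variable {L : FirstOrder.Language} {M : Type*} [L.Structure M]

@[simp] theorem autGroup_mul_apply (f g : M ≃[L] M) (x : M) : (f * g) x = f (g x) := rfl

@[simp] theorem autGroup_inv_apply_self (f : M ≃[L] M) (x : M) : f⁻¹ (f x) = x :=
  f.symm_apply_apply x

@[simp] theorem autGroup_apply_inv_self (f : M ≃[L] M) (x : M) : f (f⁻¹ x) = x :=
  f.apply_symm_apply x

theorem isInducing_aut [TopologicalSpace M] [DiscreteTopology M] :
    IsInducing (fun f : M ≃[L] M => (f : M → M)) := by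
  refine ⟨?_⟩
  rw [DiscreteTopology.eq_bot (α := M)]
  rfl

theorem isOpen_aut_iff {V : Set (M ≃[L] M)} :
    IsOpen V ↔ ∀ g ∈ V, ∃ F : Set M, F.Finite ∧ ∀ g', (∀ x ∈ F, g' x = g x) → g' ∈ V := by
  let _ : TopologicalSpace M := ⊥
  have : DiscreteTopology M := ⟨rfl⟩
  exact isInducing_aut.isOpen_iff_agree

/-- Recording the inverse along with the map makes the image closed: a pointwise limit of
automorphisms alone may fail to be surjective. -/
theorem polishSpace_aut [Countable M] : PolishSpace (M ≃[L] M) := by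
  let _ : TopologicalSpace M := ⊥
  have : DiscreteTopology M := ⟨rfl⟩
  have hcont : ∀ x : M, Continuous fun f : M ≃[L] M => f x := fun x =>
    (continuous_apply x).comp isInducing_aut.continuous
  have hinv : Continuous fun f : M ≃[L] M => ((f⁻¹ : M ≃[L] M) : M → M) := by
    refine continuous_pi fun x => ?_
    refine continuous_discrete_rng.2 fun y => isOpen_aut_iff.2 fun g hg => ⟨{y}, finite_singleton y,
      fun g' h => ?_⟩
    have h1 : g⁻¹ x = y := hg
    have h2 : g' y = g y := h y rfl
    have h3 : g' y = x := by rw [h2, ← h1]; simp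
    show g'⁻¹ x = y
    rw [← h3]; simp
  let e : (M ≃[L] M) → (M → M) × (M → M) := fun f => (f, (f⁻¹ : M ≃[L] M))
  have he : IsClosedEmbedding e := by
    refine ⟨⟨?_, ?_⟩, ?_⟩
    · refine IsInducing.of_comp (isInducing_aut.continuous.prodMk hinv) continuous_fst ?_
      exact isInducing_aut
    · intro f g h
      exact FirstOrder.Language.Equiv.ext fun x => congrFun (congrArg Prod.fst h) x
    · have : range e = {p | (∀ x, p.1 (p.2 x) = x) ∧ (∀ x, p.2 (p.1 x) = x) ∧
          (∀ n (f : L.Functions n) (x : Fin n → M), p.1 (FirstOrder.Language.Structure.funMap f x) =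
            FirstOrder.Language.Structure.funMap f (p.1 ∘ x)) ∧
          (∀ n (R : L.Relations n) (x : Fin n → M), FirstOrder.Language.Structure.RelMap R (p.1 ∘ x) ↔
            FirstOrder.Language.Structure.RelMap R x)} := by
        ext p
        constructor
        · rintro ⟨f, rfl⟩
          exact ⟨fun x => by simp [e], fun x => by simp [e], fun n F x => f.map_fun F x,
            fun n R x => f.map_rel R x⟩
        · rintro ⟨h1, h2, h3, h4⟩
          refine ⟨⟨⟨p.1, p.2, h2, h1⟩, fun {n} F x => h3 n F x, fun {n} R x => h4 n R x⟩, ?_⟩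
          rfl
      rw [this]
      have c1 : ∀ x, Continuous fun p : (M → M) × (M → M) => p.1 x := fun x =>
        (continuous_apply x).comp continuous_fst
      have c2 : ∀ x, Continuous fun p : (M → M) × (M → M) => p.2 x := fun x =>
        (continuous_apply x).comp continuous_snd
      have ev : Continuous fun q : (M → M) × M => q.1 q.2 := by
        refine continuous_prod_of_discrete_right.2 fun x => continuous_apply x
      have cand : ∀ {a b : (M → M) × (M → M) → Prop}, IsClosed {p | a p} → IsClosed {p | b p} →
          IsClosed {p | a p ∧ b p} := fun h1 h2 => h1.inter h2
      refine cand (isClosed_setOf_forall fun x => ?_) (cand (isClosed_setOf_forall fun x => ?_)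
        (cand (isClosed_setOf_forall fun n => isClosed_setOf_forall fun F => isClosed_setOf_forall fun x => ?_)
          (isClosed_setOf_forall fun n => isClosed_setOf_forall fun R => isClosed_setOf_forall fun x => ?_)))
      · exact isClosed_eq (ev.comp (continuous_fst.prodMk (c2 x))) continuous_const
      · exact isClosed_eq (ev.comp (continuous_snd.prodMk (c1 x))) continuous_const
      · refine isClosed_eq (c1 _) ?_
        exact (continuous_of_discreteTopology (f := fun y : Fin n → M =>
          FirstOrder.Language.Structure.funMap F y)).comp (continuous_pi fun j => c1 (x j))
      · exact (isClosed_discrete {y : Fin n → M | FirstOrder.Language.Structure.RelMap R y ↔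
          FirstOrder.Language.Structure.RelMap R x}).preimage (continuous_pi fun j => c1 (x j))
  have : PolishSpace ((M → M) × (M → M)) := {}
  exact he.polishSpace

theorem isOpen_commutingTuples_iff {n : ℕ} {V : Set (commutingTuples n (M ≃[L] M))} :
    IsOpen V ↔ ∀ g ∈ V, ∃ F : Set M, F.Finite ∧
      ∀ g', (∀ i, ∀ x ∈ F, g'.1 i x = g.1 i x) → g' ∈ V := by
  let _ : TopologicalSpace M := ⊥
  have : DiscreteTopology M := ⟨rfl⟩
  have h1 : IsInducing fun g : Fin n → (M ≃[L] M) => fun p : Fin n × M => g p.1 p.2 := by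
    have h2 : IsInducing fun g : Fin n → (M ≃[L] M) => fun i => ((g i : M ≃[L] M) : M → M) :=
      IsInducing.piMap fun _ => isInducing_aut
    exact (Homeomorph.piCurry (X := Fin n) (Y := M) (Z := M)).symm.isInducing.comp h2
  have h3 := h1.comp (IsInducing.subtypeVal (t := commutingTuples n (M ≃[L] M)))
  rw [h3.isOpen_iff_agree]
  refine forall₂_congr fun g _ => ⟨?_, ?_⟩
  · rintro ⟨F, hF, h⟩
    exact ⟨Prod.snd '' F, hF.image _, fun g' hg' => h g' fun j hj => hg' j.1 j.2 ⟨j, hj, rfl⟩⟩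
  · rintro ⟨F, hF, h⟩
    exact ⟨univ ×ˢ F, finite_univ.prod hF, fun g' hg' => h g' fun i x hx => hg' (i, x) ⟨trivial, hx⟩⟩

theorem isOpen_subgroup_iff {H : Subgroup (M ≃[L] M)} {V : Set H} :
    IsOpen V ↔ ∀ g ∈ V, ∃ F : Set M, F.Finite ∧
      ∀ g' : H, (∀ x ∈ F, g'.1 x = g.1 x) → g' ∈ V := by
  let _ : TopologicalSpace M := ⊥
  have : DiscreteTopology M := ⟨rfl⟩
  exact (isInducing_aut.comp (IsInducing.subtypeVal (t := (H : Set (M ≃[L] M))))).isOpen_iff_agree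

theorem baireSpace_subtype_of_isClosed {Y : Type*} [TopologicalSpace Y] [PolishSpace Y] {s : Set Y}
    (hs : IsClosed s) : BaireSpace s := by
  have := hs.polishSpace
  let _ := TopologicalSpace.upgradeIsCompletelyMetrizable s
  infer_instance

theorem isClosed_setOf_mul_eq [Countable M] {Y : Type*} [TopologicalSpace Y] {f g : Y → (M ≃[L] M)}
    (hf : Continuous f) (hg : Continuous g) : IsClosed {y | f y * g y = g y * f y} := by
  have := polishSpace_aut (L := L) (M := M)
  have : Continuous fun p : (M ≃[L] M) × (M ≃[L] M) => p.1 * p.2 := by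
    let _ : TopologicalSpace M := ⊥
    have : DiscreteTopology M := ⟨rfl⟩
    have ev : Continuous fun q : (M ≃[L] M) × M => q.1 q.2 :=
      continuous_prod_of_discrete_right.2 fun x =>
        (continuous_apply x).comp isInducing_aut.continuous
    refine isInducing_aut.continuous_iff.2 (continuous_pi fun x => ?_)
    exact ev.comp (continuous_fst.prodMk (ev.comp (continuous_snd.prodMk continuous_const)))
  exact isClosed_eq (this.comp (hf.prodMk hg)) (this.comp (hg.prodMk hf))

theorem baireSpace_commutingTuples [Countable M] (n : ℕ) :
    BaireSpace (commutingTuples n (M ≃[L] M)) := by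
  have := polishSpace_aut (L := L) (M := M)
  refine baireSpace_subtype_of_isClosed ?_
  simp only [commutingTuples, ofPred_forall]
  exact isClosed_iInter fun i => isClosed_iInter fun j =>
    isClosed_setOf_mul_eq (continuous_apply i) (continuous_apply j)

theorem baireSpace_commutant [Countable M] {n : ℕ} (g : Fin n → (M ≃[L] M)) :
    BaireSpace (commutant g) := by
  have := polishSpace_aut (L := L) (M := M)
  refine baireSpace_subtype_of_isClosed (s := (commutant g : Set (M ≃[L] M))) ?_
  have : (commutant g : Set (M ≃[L] M)) = ⋂ i, {h | g i * h = h * g i} := by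
    ext h
    simp [Subgroup.mem_centralizer_iff]
  rw [this]
  exact isClosed_iInter fun i => isClosed_setOf_mul_eq continuous_const continuous_id

end Topology

/-! ### Chains of partial automorphisms -/

section Chains

open Set

variable {L : FirstOrder.Language} {M : Type*} [L.Structure M]

/-- Injectivity and preservation of the structure involve finitely many points at a time, so they
are inherited from a single stage. Surjectivity is what `hran` is for. -/
theorem exists_equiv_of_chain (k : ℕ → (M ≃[L] M)) (A : ℕ → Set M) (hA : Monotone A)
    (hk : ∀ j, ∀ x ∈ A j, k (j + 1) x = k j x) (hdom : ∀ x, ∃ j, x ∈ A j)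
    (hran : ∀ y, ∃ j, ∃ x ∈ A j, k j x = y) :
    ∃ K : M ≃[L] M, ∀ j, ∀ x ∈ A j, K x = k j x := by
  have hk' : ∀ i j, i ≤ j → ∀ x ∈ A i, k j x = k i x := by
    intro i j hij
    induction j, hij using Nat.le_induction with
    | base => exact fun _ _ => rfl
    | succ j hij ih => exact fun x hx => (hk j x (hA hij hx)).trans (ih x hx)
  choose N hN using hdom
  let f : M → M := fun x => k (N x) x
  have hf : ∀ j, ∀ x ∈ A j, f x = k j x := fun j x hx => by
    rcases le_total (N x) j with h | h
    · exact (hk' _ _ h x (hN x)).symm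
    · exact hk' _ _ h x hx
  have hinj : Function.Injective f := fun x y h => by
    have hx := hA (le_max_left (N x) (N y)) (hN x)
    have hy := hA (le_max_right (N x) (N y)) (hN y)
    rw [hf _ x hx, hf _ y hy] at h
    exact (k _).injective h
  have hsurj : Function.Surjective f := fun y => by
    obtain ⟨j, x, hx, rfl⟩ := hran y
    exact ⟨x, hf j x hx⟩
  have htup : ∀ {n : ℕ} (x : Fin n → M) (y : M), ∃ j, (∀ i, x i ∈ A j) ∧ y ∈ A j := fun x y => by
    refine ⟨(Finset.univ.sup fun i => N (x i)) ⊔ N y, fun i => hA ?_ (hN (x i)), hA ?_ (hN y)⟩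
    · exact le_sup_of_le_left (Finset.le_sup (f := fun i => N (x i)) (Finset.mem_univ i))
    · exact le_sup_right
  refine ⟨⟨Equiv.ofBijective f ⟨hinj, hsurj⟩, ?_, ?_⟩, fun j x hx => hf j x hx⟩
  · intro n F x
    obtain ⟨j, hx, hy⟩ := htup x (FirstOrder.Language.Structure.funMap F x)
    have : f ∘ x = k j ∘ x := funext fun i => hf j _ (hx i)
    show f _ = FirstOrder.Language.Structure.funMap F (f ∘ x)
    rw [hf j _ hy, this]
    exact (k j).map_fun F x
  · intro n R x
    rcases isEmpty_or_nonempty M with hM | ⟨⟨y⟩⟩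
    · have : f ∘ x = x := funext fun i => hM.elim (x i)
      show FirstOrder.Language.Structure.RelMap R (f ∘ x) ↔ _
      rw [this]
    obtain ⟨j, hx, -⟩ := htup x y
    have : f ∘ x = k j ∘ x := funext fun i => hf j _ (hx i)
    show FirstOrder.Language.Structure.RelMap R (f ∘ x) ↔ _
    rw [this]
    exact (k j).map_rel R x

theorem exists_finite_exhaustion (M : Type*) [Countable M] :
    ∃ F : ℕ → Set M, (∀ j, (F j).Finite) ∧ ∀ x, ∃ j, x ∈ F j := by
  obtain ⟨f, hf⟩ := exists_injective_nat M
  exact ⟨fun j => {x | f x = j}, fun j => Set.Subsingleton.finite fun x hx y hy =>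
    hf (hx.trans hy.symm), fun x => ⟨f x, rfl⟩⟩

/-- Here `Q A k` is an approximation of which only `k` on `A` survives in the limit. Absorbing each
`F` into the images as well makes the limit surjective. The index type is `Fin n` when building
commuting tuples and `Unit` when building one conjugator. -/
theorem exists_limit_of_extension [Countable M] {ι : Type*} (Q : Set M → (ι → (M ≃[L] M)) → Prop)
    (hQ : ∀ A k, Q A k → ∀ F : Set M, F.Finite → ∃ A' k', Q A' k' ∧ A ⊆ A' ∧ F ⊆ A' ∧
      (∀ i, F ⊆ k' i '' A') ∧ ∀ i, ∀ x ∈ A, k' i x = k i x)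
    (A : Set M) (k : ι → (M ≃[L] M)) (h : Q A k) :
    ∃ K : ι → (M ≃[L] M), (∀ i, ∀ x ∈ A, K i x = k i x) ∧
      ∀ F : Set M, F.Finite → ∃ A' k', Q A' k' ∧ F ⊆ A' ∧ ∀ i, ∀ x ∈ A', K i x = k' i x := by
  obtain ⟨F, hF, hcov⟩ := exists_finite_exhaustion M
  choose! nA nk h1 h2 h3 h4 h5 using hQ
  let s : ℕ → Set M × (ι → (M ≃[L] M)) := fun j =>
    Nat.rec (A, k) (fun j p => (nA p.1 p.2 (F j), nk p.1 p.2 (F j))) j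
  have hs : ∀ j, Q (s j).1 (s j).2 := fun j => by
    induction j with
    | zero => exact h
    | succ j ih => exact h1 _ _ ih _ (hF j)
  have hmono : Monotone fun j => (s j).1 :=
    monotone_nat_of_le_succ fun j => h2 _ _ (hs j) _ (hF j)
  have hlim : ∀ i, ∃ K : M ≃[L] M, ∀ j, ∀ x ∈ (s j).1, K x = (s j).2 i x := fun i => by
    refine exists_equiv_of_chain (fun j => (s j).2 i) (fun j => (s j).1) hmono
      (fun j x hx => h5 _ _ (hs j) _ (hF j) i x hx) (fun x => ?_) (fun y => ?_)
    · obtain ⟨j, hj⟩ := hcov x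
      exact ⟨j + 1, h3 _ _ (hs j) _ (hF j) hj⟩
    · obtain ⟨j, hj⟩ := hcov y
      exact ⟨j + 1, h4 _ _ (hs j) _ (hF j) i hj⟩
  choose K hK using hlim
  refine ⟨K, fun i x hx => hK i 0 x hx, fun E hE => ?_⟩
  have : ∃ j, E ⊆ (s j).1 := by
    induction E, hE using Set.Finite.induction_on with
    | empty => exact ⟨0, empty_subset _⟩
    | insert _ _ ih =>
      rename_i a E _ _
      obtain ⟨j, hj⟩ := ih
      obtain ⟨l, hl⟩ := hcov a
      refine ⟨max j (l + 1), insert_subset ?_ (hj.trans (hmono (le_max_left _ _)))⟩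
      exact hmono (le_max_right _ _) (h3 _ _ (hs l) _ (hF l) hl)
  obtain ⟨j, hj⟩ := this
  exact ⟨(s j).1, (s j).2, hs j, hj, fun i x hx => hK i j x hx⟩

end Chains

/-! ### Locally finite commuting tuples with the extension property -/

section LocallyFinite

open Set

variable {L : FirstOrder.Language} {M : Type*} [L.Structure M] {n : ℕ}

/-- The set `B` is mapped into itself by every entry of the tuple `g`. -/
def IsInvariantUnder (g : Fin n → (M ≃[L] M)) (B : Set M) : Prop :=
  ∀ i, ∀ x ∈ B, g i x ∈ B

/-- Every finite set is contained in a finite invariant set. -/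
def IsLocallyFiniteTuple (g : Fin n → (M ≃[L] M)) : Prop :=
  ∀ F : Set M, F.Finite → ∃ B : Set M, B.Finite ∧ F ⊆ B ∧ IsInvariantUnder g B

/-- Every finite extension, within commuting tuples, of a finite piece of `g` is realised in `g`
over that piece. -/
def HasExtensionProperty (g : Fin n → (M ≃[L] M)) : Prop :=
  ∀ p ∈ commutingTuples n (M ≃[L] M), ∀ A B : Set M, B.Finite → A ⊆ B → IsInvariantUnder p A →
    IsInvariantUnder p B → (∀ i, ∀ x ∈ A, p i x = g i x) →
      ∃ k : M ≃[L] M, (∀ x ∈ A, k x = x) ∧ ∀ i, ∀ x ∈ B, k (p i x) = g i (k x)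

/-- Commuting tuples that are locally finite and have the extension property. -/
def IsUniversalTuple (g : Fin n → (M ≃[L] M)) : Prop :=
  g ∈ commutingTuples n (M ≃[L] M) ∧ IsLocallyFiniteTuple g ∧ HasExtensionProperty g

variable (L M) in
/-- Commuting tuples can be approximated by commuting tuples with a finite invariant set. -/
def HasFiniteApproximations (n : ℕ) : Prop :=
  ∀ g ∈ commutingTuples n (M ≃[L] M), ∀ F : Set M, F.Finite →
    ∃ g' ∈ commutingTuples n (M ≃[L] M), (∀ i, ∀ x ∈ F, g' i x = g i x) ∧
      ∃ B : Set M, B.Finite ∧ F ⊆ B ∧ IsInvariantUnder g' B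

variable (L M) in
/-- Finite pieces of commuting tuples can be amalgamated over a common piece. -/
def HasTupleAmalgamation (n : ℕ) : Prop :=
  ∀ p ∈ commutingTuples n (M ≃[L] M), ∀ q ∈ commutingTuples n (M ≃[L] M),
    ∀ A B C : Set M, B.Finite → C.Finite → A ⊆ B → A ⊆ C → IsInvariantUnder p A →
      IsInvariantUnder p B → IsInvariantUnder q C → (∀ i, ∀ x ∈ A, p i x = q i x) →
        ∃ k : M ≃[L] M, ∃ r ∈ commutingTuples n (M ≃[L] M), (∀ x ∈ A, k x = x) ∧
          (∀ i, ∀ x ∈ C, r i x = q i x) ∧ ∀ i, ∀ x ∈ B, r i (k x) = k (p i x)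

/-! ### Back-and-forth between universal tuples -/

theorem conj_mem_commutingTuples {G : Type*} [Group G] {g : Fin n → G}
    (hg : g ∈ commutingTuples n G) (k : G) :
    (fun i => k * g i * k⁻¹) ∈ commutingTuples n G := fun i j => by
  have := hg i j
  simp only [mul_assoc, inv_mul_cancel_left]
  rw [← mul_assoc (g i), this, mul_assoc]

theorem IsUniversalTuple.conj {g : Fin n → (M ≃[L] M)} (hg : IsUniversalTuple g) (k : M ≃[L] M) :
    IsUniversalTuple fun i => k * g i * k⁻¹ := by
  refine ⟨conj_mem_commutingTuples hg.1 k, fun F hF => ?_, fun p hp A B hB hAB hA hpB hpA => ?_⟩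
  · obtain ⟨B, hB, hFB, hinv⟩ := hg.2.1 ((fun x => k⁻¹ x) '' F) (hF.image _)
    refine ⟨k '' B, hB.image _, fun x hx => ⟨k⁻¹ x, hFB ⟨x, hx, rfl⟩, by simp⟩, ?_⟩
    rintro i _ ⟨x, hx, rfl⟩
    exact ⟨g i x, hinv i x hx, by simp⟩
  · obtain ⟨l, hl, hl'⟩ := hg.2.2 (fun i => k⁻¹ * p i * k⁻¹⁻¹) (conj_mem_commutingTuples hp k⁻¹)
      ((fun x => k⁻¹ x) '' A) ((fun x => k⁻¹ x) '' B) (hB.image _) (image_mono hAB)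
      (by rintro i _ ⟨x, hx, rfl⟩; exact ⟨p i x, hA i x hx, by simp⟩)
      (by rintro i _ ⟨x, hx, rfl⟩; exact ⟨p i x, hpB i x hx, by simp⟩)
      (by rintro i _ ⟨x, hx, rfl⟩; simp [hpA i x hx])
    refine ⟨k * l * k⁻¹, fun x hx => ?_, fun i x hx => ?_⟩
    · simp [hl _ ⟨x, hx, rfl⟩]
    · have := hl' i _ ⟨x, hx, rfl⟩
      simp at this
      simp [this]

theorem IsInvariantUnder.image {g g' : Fin n → (M ≃[L] M)} {A : Set M} (hA : IsInvariantUnder g A)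
    {k : M ≃[L] M} (hk : ∀ i, ∀ x ∈ A, k (g i x) = g' i (k x)) : IsInvariantUnder g' (k '' A) := by
  rintro i _ ⟨x, hx, rfl⟩
  exact ⟨g i x, hA i x hx, hk i x hx⟩

/-- Conjugating `g` by `k` gives a commuting tuple that agrees with `g'` on the image of `A`. The
extension property of `g'` then supplies a correction `l` fixing that image. -/
theorem exists_forth {g g' : Fin n → (M ≃[L] M)} (hg : g ∈ commutingTuples n (M ≃[L] M))
    (hlf : IsLocallyFiniteTuple g) (hg' : HasExtensionProperty g') {A : Set M} (hA : A.Finite)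
    (hinv : IsInvariantUnder g A) {k : M ≃[L] M} (hk : ∀ i, ∀ x ∈ A, k (g i x) = g' i (k x))
    {F : Set M} (hF : F.Finite) :
    ∃ (A' : Set M) (k' : M ≃[L] M), A'.Finite ∧ IsInvariantUnder g A' ∧ A ⊆ A' ∧ F ⊆ A' ∧
      (∀ x ∈ A, k' x = k x) ∧ ∀ i, ∀ x ∈ A', k' (g i x) = g' i (k' x) := by
  obtain ⟨B, hB, hAB, hBinv⟩ := hlf (A ∪ F) (hA.union hF)
  have hc : ∀ i x, (k * g i * k⁻¹) (k x) = k (g i x) := by simp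
  have hinv' : ∀ {C : Set M}, IsInvariantUnder g C →
      IsInvariantUnder (fun i => k * g i * k⁻¹) (k '' C) := fun h =>
    h.image fun i x _ => (hc i x).symm
  obtain ⟨l, hl, hl'⟩ := hg' _ (conj_mem_commutingTuples hg k) (k '' A) (k '' B) (hB.image _)
    (image_mono (subset_union_left.trans hAB)) (hinv' hinv) (hinv' hBinv)
    (by rintro i _ ⟨x, hx, rfl⟩; rw [hc, hk i x hx])
  refine ⟨B, l * k, hB, hBinv, subset_union_left.trans hAB, subset_union_right.trans hAB,
    fun x hx => hl _ ⟨x, hx, rfl⟩, fun i x hx => ?_⟩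
  have := hl' i _ ⟨x, hx, rfl⟩
  rwa [hc] at this

theorem exists_extension_of_isUniversalTuple [Countable M] {g g' : Fin n → (M ≃[L] M)}
    (hg : IsUniversalTuple g) (hg' : IsUniversalTuple g') {A : Set M} (hA : A.Finite)
    (hinv : IsInvariantUnder g A) {k : M ≃[L] M} (hk : ∀ i, ∀ x ∈ A, k (g i x) = g' i (k x)) :
    ∃ K : M ≃[L] M, (∀ x ∈ A, K x = k x) ∧ ∀ i x, K (g i x) = g' i (K x) := by
  obtain ⟨K, hK, hlim⟩ := exists_limit_of_extension (ι := Unit)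
    (fun A k => A.Finite ∧ IsInvariantUnder g A ∧ ∀ i, ∀ x ∈ A, k () (g i x) = g' i (k () x))
    (by
      rintro A k ⟨hA, hinv, hk⟩ F hF
      obtain ⟨A₁, k₁, hA₁, hinv₁, hAA₁, hFA₁, hkk₁, hk₁⟩ :=
        exists_forth hg.1 hg.2.1 hg'.2.2 hA hinv hk hF
      -- The "back" half: the same step for `k₁⁻¹` with the two tuples exchanged. The new domain is
      -- the image of `A₂` under `k₂`, and the new map is `k₂⁻¹`.
      obtain ⟨A₂, k₂, hA₂, hinv₂, hAA₂, hFA₂, hkk₂, hk₂⟩ :=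
        exists_forth (k := k₁⁻¹) hg'.1 hg'.2.1 hg.2.2 (hA₁.image k₁) (hinv₁.image hk₁)
          (by rintro i _ ⟨x, hx, rfl⟩; rw [← hk₁ i x hx]; simp) hF
      have hA : ∀ x ∈ A₁, k₂ (k₁ x) = x := fun x hx => by
        rw [hkk₂ _ ⟨x, hx, rfl⟩]; simp
      have hsub : A₁ ⊆ k₂ '' A₂ := fun x hx => ⟨k₁ x, hAA₂ ⟨x, hx, rfl⟩, hA x hx⟩
      refine ⟨k₂ '' A₂, fun _ => k₂⁻¹, ⟨hA₂.image _, hinv₂.image hk₂, ?_⟩, hAA₁.trans hsub,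
        hFA₁.trans hsub, fun _ y hy => ⟨k₂ y, ⟨y, hFA₂ hy, rfl⟩, by simp⟩, fun _ x hx => ?_⟩
      · rintro i _ ⟨x, hx, rfl⟩
        rw [← hk₂ i x hx]; simp
      · rw [← hkk₁ x hx, ← hA x (hAA₁ hx), autGroup_inv_apply_self, hA x (hAA₁ hx)])
    A (fun _ => k) ⟨hA, hinv, hk⟩
  refine ⟨K (), hK (), fun i x => ?_⟩
  obtain ⟨A', k', ⟨-, hinv', hk'⟩, hx, hKk⟩ := hlim {x} (finite_singleton x)
  rw [singleton_subset_iff] at hx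
  rw [hKk () x hx, hKk () _ (hinv' i x hx)]
  exact hk' i x hx

theorem IsUniversalTuple.mem_diagonalClass [Countable M] {g g' : Fin n → (M ≃[L] M)}
    (hg : IsUniversalTuple g) (hg' : IsUniversalTuple g') : g' ∈ diagonalClass g := by
  obtain ⟨K, -, hK⟩ := exists_extension_of_isUniversalTuple hg hg' (k := 1) finite_empty
    (fun _ _ h => h.elim) (fun _ _ h => h.elim)
  refine ⟨K, fun i => FirstOrder.Language.Equiv.ext fun x => ?_⟩
  rw [autGroup_mul_apply, autGroup_mul_apply, hK]
  simp

theorem mem_commutant_iff {g : Fin n → (M ≃[L] M)} {h : M ≃[L] M} :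
    h ∈ commutant g ↔ ∀ i x, h (g i x) = g i (h x) := by
  rw [Subgroup.mem_centralizer_iff]
  constructor
  · intro H i x
    exact (congrArg (fun f : M ≃[L] M => f x) (H _ ⟨i, rfl⟩)).symm
  · rintro H _ ⟨i, rfl⟩
    exact FirstOrder.Language.Equiv.ext fun x => (H i x).symm

end LocallyFinite

/-! ### Genericity of universal tuples -/

section Generic

open Set

variable {L : FirstOrder.Language} {M : Type*} [L.Structure M] [Countable M] {n : ℕ}

/-- Stated for a family `τ` of tuples over a space `Y` so that it covers both the space of all
commuting tuples and the tuples (g, h) with h in a commutant. -/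
theorem residual_isUniversalTuple {Y : Type*} [TopologicalSpace Y] (τ : Y → Fin n → (M ≃[L] M))
    (hτ : ∀ V : Set Y, IsOpen V ↔ ∀ y ∈ V, ∃ F : Set M, F.Finite ∧
      ∀ y', (∀ i, ∀ x ∈ F, τ y' i x = τ y i x) → y' ∈ V)
    (hcomm : ∀ y, τ y ∈ commutingTuples n (M ≃[L] M))
    (hfin : ∀ y, ∀ F : Set M, F.Finite → ∃ y', (∀ i, ∀ x ∈ F, τ y' i x = τ y i x) ∧
      ∃ B : Set M, B.Finite ∧ F ⊆ B ∧ IsInvariantUnder (τ y') B)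
    (ham : ∀ y, ∀ p ∈ commutingTuples n (M ≃[L] M), ∀ A B C : Set M, B.Finite → C.Finite → A ⊆ B →
      A ⊆ C → IsInvariantUnder p A → IsInvariantUnder p B → IsInvariantUnder (τ y) C →
        (∀ i, ∀ x ∈ A, p i x = τ y i x) → ∃ (k : M ≃[L] M) (y' : Y), (∀ x ∈ A, k x = x) ∧
          (∀ i, ∀ x ∈ C, τ y' i x = τ y i x) ∧ ∀ i, ∀ x ∈ B, τ y' i (k x) = k (p i x)) :
    {y | IsUniversalTuple (τ y)} ∈ residual Y := by
  have hdense : ∀ V : Set Y, (∀ y, ∀ F : Set M, F.Finite →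
      ∃ y' ∈ V, ∀ i, ∀ x ∈ F, τ y' i x = τ y i x) → Dense V := fun V h => by
    refine dense_iff_inter_open.2 fun W hW ⟨y, hy⟩ => ?_
    obtain ⟨F, hF, hFW⟩ := (hτ W).1 hW y hy
    obtain ⟨y', hy', h'⟩ := h y F hF
    exact ⟨y', hFW y' h', hy'⟩
  have hlf : ∀ F : Finset M,
      {y | ∃ B : Set M, B.Finite ∧ (F : Set M) ⊆ B ∧ IsInvariantUnder (τ y) B} ∈ residual Y := by
    refine fun F => residual_of_dense_open ((hτ _).2 ?_) (hdense _ fun y E hE => ?_)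
    · rintro y ⟨B, hB, hFB, hinv⟩
      exact ⟨B, hB, fun y' h => ⟨B, hB, hFB, fun i x hx => by rw [h i x hx]; exact hinv i x hx⟩⟩
    · obtain ⟨y', h, B, hB, hsub, hinv⟩ := hfin y (E ∪ F) (hE.union F.finite_toSet)
      exact ⟨y', ⟨B, hB, subset_union_right.trans hsub, hinv⟩, fun i x hx => h i x (Or.inl hx)⟩
  -- Only the values `d` of `p` on the finite set `B` matter, so countably many conditions replace
  -- the uncountably many `p`.
  let R : (A B : Finset M) → (Fin n → B → M) → (Fin n → (M ≃[L] M)) → Y → Prop := fun A B d p y =>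
    p ∈ commutingTuples n (M ≃[L] M) ∧ (∀ i (x : B), p i x = d i x) ∧
      IsInvariantUnder p (A : Set M) ∧ IsInvariantUnder p (B : Set M) ∧
      ∀ i, ∀ x ∈ (A : Set M), p i x = τ y i x
  have hext : ∀ (A B : Finset M) (d : Fin n → B → M), A ⊆ B →
      {y | ∀ p, R A B d p y → ∃ k : M ≃[L] M, (∀ x ∈ (A : Set M), k x = x) ∧
        ∀ i, ∀ x ∈ (B : Set M), k (p i x) = τ y i (k x)} ∈ residual Y := by
    refine fun A B d hAB => residual_of_dense_open ((hτ _).2 fun y hy => ?_)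
      (hdense _ fun y E hE => ?_)
    -- One witness `k` serves every `p` with data `d`. If no such `p` exists, agreement on `A` keeps
    -- the condition vacuous nearby.
    · by_cases hp : ∃ p, R A B d p y
      · obtain ⟨p, hp⟩ := hp
        obtain ⟨k, hk, hk'⟩ := hy p hp
        refine ⟨A ∪ k '' B, A.finite_toSet.union (B.finite_toSet.image k), fun y' h p' hp' =>
          ⟨k, hk, fun i x hx => ?_⟩⟩
        rw [h i _ (Or.inr ⟨x, hx, rfl⟩), ← hk' i x hx, hp'.2.1 i ⟨x, hx⟩, hp.2.1 i ⟨x, hx⟩]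
      · refine ⟨A, A.finite_toSet, fun y' h p' hp' => (hp ⟨p', ?_⟩).elim⟩
        exact ⟨hp'.1, hp'.2.1, hp'.2.2.1, hp'.2.2.2.1, fun i x hx => by
          rw [← h i x hx, hp'.2.2.2.2 i x hx]⟩
    -- Amalgamation needs finite pieces on both sides, so `y` is first replaced by a nearby point
    -- with a finite invariant set containing `E` and `A`.
    · obtain ⟨y₁, h₁, C, hC, hsub, hinv⟩ := hfin y (E ∪ A) (hE.union A.finite_toSet)
      by_cases hp : ∃ p, R A B d p y₁
      · obtain ⟨p, hp⟩ := hp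
        obtain ⟨k, y₂, hk, h₂, hk'⟩ := ham y₁ p hp.1 A B C B.finite_toSet hC
          (Finset.coe_subset.2 hAB) (subset_union_right.trans hsub) hp.2.2.1 hp.2.2.2.1 hinv
          hp.2.2.2.2
        refine ⟨y₂, fun p' hp' => ⟨k, hk, fun i x hx => ?_⟩, fun i x hx => ?_⟩
        · rw [hk' i x hx, hp'.2.1 i ⟨x, hx⟩, hp.2.1 i ⟨x, hx⟩]
        · rw [h₂ i x (hsub (Or.inl hx)), h₁ i x (Or.inl hx)]
      · exact ⟨y₁, fun p hp' => (hp ⟨p, hp'⟩).elim, fun i x hx => h₁ i x (Or.inl hx)⟩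
  have hlf' := countable_iInter_mem.2 hlf
  have hext' := countable_iInter_mem.2 fun A : Finset M => countable_iInter_mem.2 fun B : Finset M =>
    countable_iInter_mem.2 fun d : Fin n → B → M =>
      countable_iInter_mem.2 fun h : PLift (A ⊆ B) => hext A B d h.down
  filter_upwards [hlf', hext'] with y hy₁ hy₂
  simp only [mem_iInter] at hy₁ hy₂
  refine ⟨hcomm y, fun F hF => ?_, fun p hp A B hB hAB hpA hpB h => ?_⟩
  · lift F to Finset M using hF
    exact hy₁ F
  · lift A to Finset M using hB.subset hAB
    lift B to Finset M using hB
    exact hy₂ A B (fun i x => p i x) ⟨Finset.coe_subset.1 hAB⟩ p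
      ⟨hp, fun _ _ => rfl, hpA, hpB, h⟩

theorem residual_commutingTuples_isUniversalTuple (hfin : HasFiniteApproximations L M n)
    (ham : HasTupleAmalgamation L M n) :
    {g : commutingTuples n (M ≃[L] M) | IsUniversalTuple g.1} ∈
      residual (commutingTuples n (M ≃[L] M)) := by
  refine residual_isUniversalTuple (fun g : commutingTuples n (M ≃[L] M) => g.1) (fun V => isOpen_commutingTuples_iff)
    (fun g => g.2) (fun g F hF => ?_)
    (fun g p hp A B C hB hC hAB hAC hpA hpB hgC h => ?_)
  · obtain ⟨g', hg', h⟩ := hfin g g.2 F hF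
    exact ⟨⟨g', hg'⟩, h⟩
  · obtain ⟨k, r, hr, h⟩ := ham p hp g g.2 A B C hB hC hAB hAC hpA hpB hgC h
    exact ⟨k, ⟨r, hr⟩, h⟩

/-- A comeagre orbit meets the comeagre set of universal tuples by Baire, and universality is
invariant under conjugation. Conversely, all universal tuples lie in one orbit. -/
theorem isGenericCommutingTuple_iff (hfin : HasFiniteApproximations L M n)
    (ham : HasTupleAmalgamation L M n) {g : Fin n → (M ≃[L] M)} :
    IsGenericCommutingTuple g ↔ IsUniversalTuple g := by
  have hres := residual_commutingTuples_isUniversalTuple hfin ham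
  constructor
  · rintro ⟨hg, hg'⟩
    have := baireSpace_commutingTuples (L := L) (M := M) n
    have : Nonempty (commutingTuples n (M ≃[L] M)) := ⟨⟨g, hg⟩⟩
    obtain ⟨h, hu, k, hk⟩ := (dense_of_mem_residual (Filter.inter_mem hres hg')).nonempty
    have : g = fun i => k⁻¹ * h.1 i * k⁻¹⁻¹ := funext fun i => by rw [hk i]; group
    rw [this]
    exact IsUniversalTuple.conj hu k⁻¹
  · intro hg
    refine ⟨hg.1, ?_⟩
    filter_upwards [hres] with h hh
    exact hg.mem_diagonalClass hh

theorem exists_isUniversalTuple (hfin : HasFiniteApproximations L M n)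
    (ham : HasTupleAmalgamation L M n) : ∃ g : Fin n → (M ≃[L] M), IsUniversalTuple g := by
  have := baireSpace_commutingTuples (L := L) (M := M) n
  have : Nonempty (commutingTuples n (M ≃[L] M)) := ⟨⟨fun _ => 1, fun _ _ => rfl⟩⟩
  obtain ⟨h, hu⟩ :=
    (dense_of_mem_residual (residual_commutingTuples_isUniversalTuple hfin ham)).nonempty
  exact ⟨h, hu⟩

/-! ### Genericity inside the commutant of a universal tuple -/

theorem snoc_mem_commutingTuples {G : Type*} [Group G] {g : Fin n → G}
    (hg : g ∈ commutingTuples n G) (h : commutant g) :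
    (Fin.snoc g (h : G) : Fin (n + 1) → G) ∈ commutingTuples (n + 1) G := by
  have hh : ∀ i, g i * h = h * g i := fun i => Subgroup.mem_centralizer_iff.1 h.2 _ ⟨i, rfl⟩
  intro i j
  refine Fin.lastCases ?_ (fun i => ?_) i <;> refine Fin.lastCases ?_ (fun j => ?_) j
  · rfl
  · simpa using (hh j).symm
  · simpa using hh i
  · simpa using hg i j

theorem castSucc_mem_commutingTuples {G : Type*} [Group G] {g : Fin (n + 1) → G}
    (hg : g ∈ commutingTuples (n + 1) G) : (fun i : Fin n => g i.castSucc) ∈ commutingTuples n G :=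
  fun _ _ => hg _ _

/-- A finite piece of a commuting `(n + 1)`-tuple whose first `n` entries agree with a universal
tuple `g` on an invariant subset is realised, over that subset, by `g` and an element of its
commutant. -/
theorem IsUniversalTuple.exists_commutant {g : Fin n → (M ≃[L] M)} (hg : IsUniversalTuple g)
    {r : Fin (n + 1) → (M ≃[L] M)} (hr : r ∈ commutingTuples (n + 1) (M ≃[L] M)) {A B : Set M}
    (hB : B.Finite) (hAB : A ⊆ B)
    (hA : IsInvariantUnder (fun i : Fin n => r i.castSucc) A) (hB' : IsInvariantUnder r B)
    (hrg : ∀ i : Fin n, ∀ x ∈ A, r i.castSucc x = g i x) :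
    ∃ (h : commutant g) (l : M ≃[L] M), (∀ x ∈ A, l x = x) ∧
      ∀ i, ∀ x ∈ B, l (r i x) = (Fin.snoc g (h : M ≃[L] M) : Fin (n + 1) → _) i (l x) := by
  obtain ⟨l, hl, hl'⟩ := hg.2.2 _ (castSucc_mem_commutingTuples hr) A B hB hAB hA
    (fun i => hB' _) hrg
  -- The last entry transported by `l` commutes with `g` on the finite invariant set `l '' B`, so it
  -- is a finite partial isomorphism from `g` to itself.
  obtain ⟨h, hh, hh'⟩ := exists_extension_of_isUniversalTuple hg hg (A := l '' B)
    (k := l * r (Fin.last n) * l⁻¹) (hB.image l)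
    (IsInvariantUnder.image (g := fun i : Fin n => r i.castSucc) (fun i => hB' _) hl') (by
      rintro i _ ⟨x, hx, rfl⟩
      have h1 := congrArg (fun f : M ≃[L] M => f x) (hr (Fin.last n) i.castSucc)
      simp only [autGroup_mul_apply, autGroup_inv_apply_self] at h1 ⊢
      rw [← hl' i x hx, autGroup_inv_apply_self, h1, ← hl' i _ (hB' _ x hx)])
  refine ⟨⟨h, mem_commutant_iff.2 hh'⟩, l, hl, fun i => ?_⟩
  refine Fin.lastCases (fun x hx => ?_) (fun i x hx => ?_) i
  · have := hh _ ⟨x, hx, rfl⟩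
    simp only [Fin.snoc_last]
    rw [this]
    simp
  · simpa using hl' i x hx

theorem residual_commutant_isUniversalTuple (hfin : HasFiniteApproximations L M (n + 1))
    (ham : HasTupleAmalgamation L M (n + 1)) {g : Fin n → (M ≃[L] M)} (hg : IsUniversalTuple g) :
    {h : commutant g | IsUniversalTuple (n := n + 1) (Fin.snoc g (h : M ≃[L] M))} ∈
      residual (commutant g) := by
  refine residual_isUniversalTuple (n := n + 1)
    (fun h : commutant g => (Fin.snoc g (h : M ≃[L] M) : Fin (n + 1) → (M ≃[L] M)))
    (fun V => ?_) (fun h => snoc_mem_commutingTuples hg.1 h) (fun h F hF => ?_)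
    (fun h p hp A B C hB hC hAB hAC hpA hpB hgC hpg => ?_)
  · rw [isOpen_subgroup_iff]
    refine forall₂_congr fun h _ => exists_congr fun F => and_congr_right fun _ =>
      forall_congr' fun h' => imp_congr_left ⟨fun H i => ?_, fun H x hx => ?_⟩
    · refine Fin.lastCases (fun x hx => ?_) (fun i x hx => ?_) i
      · simpa using H x hx
      · simp
    · simpa using H (Fin.last n) x hx
  -- The set `E` contains the images of `F` under `h` too: `l` fixes `E` pointwise, so the new
  -- commutant element takes the values of `h` on `F`.
  · obtain ⟨E, hE, hFE, hEinv⟩ := hg.2.1 (F ∪ h.1 '' F) (hF.union (hF.image _))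
    obtain ⟨r, hr, hrg, B, hB, hEB, hBinv⟩ := hfin _ (snoc_mem_commutingTuples hg.1 h) E hE
    have hrg' : ∀ i : Fin n, ∀ x ∈ E, r i.castSucc x = g i x := fun i x hx => by
      simpa using hrg i.castSucc x hx
    obtain ⟨h', l, hl, hl'⟩ := hg.exists_commutant hr hB hEB
      (fun i x hx => by rw [hrg' i x hx]; exact hEinv i x hx) hBinv hrg'
    refine ⟨h', fun i => ?_, l '' B, hB.image l, fun x hx => ?_, hBinv.image hl'⟩
    · refine Fin.lastCases (fun x hx => ?_) (fun i x hx => ?_) i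
      · have hxE := hFE (Or.inl hx)
        have h1 := hl' (Fin.last n) x (hEB hxE)
        have h2 := hrg (Fin.last n) x hxE
        rw [hl x hxE] at h1
        rw [← h1, h2]
        simp only [Fin.snoc_last]
        exact hl _ (hFE (Or.inr ⟨x, hx, rfl⟩))
      · simp
    · exact ⟨x, hEB (hFE (Or.inl hx)), hl x (hFE (Or.inl hx))⟩
  · obtain ⟨k, r, hr, hk, hrC, hrB⟩ := ham p hp _ (snoc_mem_commutingTuples hg.1 h) A B C hB hC
      hAB hAC hpA hpB hgC hpg
    have hrC' : IsInvariantUnder r C := fun i x hx => by rw [hrC i x hx]; exact hgC i x hx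
    have hrB' : IsInvariantUnder r (k '' B) := hpB.image fun i x hx => (hrB i x hx).symm
    -- The amalgam `r` need not begin with `g`, but on `C` it does. Its piece on `C ∪ k '' B` is
    -- therefore moved into `g` while `C` stays fixed.
    obtain ⟨h', l, hl, hl'⟩ := hg.exists_commutant (A := C) (B := C ∪ k '' B) hr
      (hC.union (hB.image k)) subset_union_left (fun i => hrC' _)
      (fun i x hx => hx.imp (hrC' i x) (hrB' i x))
      (fun i x hx => by simpa using hrC i.castSucc x hx)
    refine ⟨l * k, h', fun x hx => ?_, fun i x hx => ?_, fun i x hx => ?_⟩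
    · rw [autGroup_mul_apply, hk x hx, hl x (hAC hx)]
    · have := hl' i x (Or.inl hx)
      rw [hl x hx] at this
      rw [← this, hl _ (hrC' i x hx), hrC i x hx]
    · rw [autGroup_mul_apply, autGroup_mul_apply, ← hl' i _ (Or.inr ⟨x, hx, rfl⟩), hrB i x hx]

/-- A conjugator between (g, h) and (g, h') commutes with every entry of g, so h and h' are
conjugate within the commutant. -/
theorem exists_conjugatesOf_mem_residual {g : Fin n → (M ≃[L] M)}
    (hres : {h : commutant g | IsUniversalTuple (n := n + 1) (Fin.snoc g (h : M ≃[L] M))} ∈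
      residual (commutant g)) : ∃ h : commutant g, conjugatesOf h ∈ residual (commutant g) := by
  have := baireSpace_commutant g
  obtain ⟨h, hu⟩ := (dense_of_mem_residual hres).nonempty
  refine ⟨h, ?_⟩
  filter_upwards [hres] with h' hu'
  obtain ⟨k, hk⟩ := IsUniversalTuple.mem_diagonalClass hu hu'
  have hkg : k ∈ commutant g := by
    rintro _ ⟨i, rfl⟩
    have := hk i.castSucc
    simp only [Fin.snoc_castSucc] at this
    nth_rewrite 1 [this]
    group
  have := hk (Fin.last n)
  simp only [Fin.snoc_last] at this
  exact isConj_iff.2 ⟨⟨k, hkg⟩, Subtype.ext this.symm⟩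

end Generic

/-! ### Ultrametric structures with distances in a linear order -/

namespace RandomisedUltrametricData

open FirstOrder

variable (D : RandomisedUltrametricData)

/-- The possible distances of distinct points: the elements of `S`, or a single value if `S` is
empty. -/
def Dist : Type := {t : WithTop D.S // t = ⊤ → IsEmpty D.S}

noncomputable instance : LinearOrder D.Dist :=
  inferInstanceAs (LinearOrder {t : WithTop D.S // t = ⊤ → IsEmpty D.S})

variable {D} in
/-- An element of `S` as a distance. -/
def dist (s : D.S) : D.Dist := ⟨s, fun h => absurd h (WithTop.coe_ne_top)⟩

theorem dist_le_dist {s t : D.S} : dist s ≤ dist t ↔ s ≤ t := WithTop.coe_le_coe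

theorem dist_lt_dist {s t : D.S} : dist s < dist t ↔ s < t := WithTop.coe_lt_coe

instance : Nonempty D.Dist := by
  by_cases h : IsEmpty D.S
  · exact ⟨⟨⊤, fun _ => h⟩⟩
  · rw [not_isEmpty_iff] at h
    exact h.map dist

theorem exists_eq_dist [Nonempty D.S] (t : D.Dist) : ∃ s, t = dist s := by
  obtain ⟨t, ht⟩ := t
  induction t using WithTop.recTopCoe with
  | top => exact (not_isEmpty_of_nonempty D.S (ht rfl)).elim
  | coe s => exact ⟨s, rfl⟩

theorem subsingleton_dist [IsEmpty D.S] : Subsingleton D.Dist := by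
  refine ⟨fun a b => Subtype.ext ?_⟩
  have : ∀ t : WithTop D.S, t = ⊤ := fun t => by
    induction t using WithTop.recTopCoe with
    | top => rfl
    | coe s => exact isEmptyElim s
  rw [this a.1, this b.1]

/-- If `S` is nonempty, a violating `v` is itself a threshold. The hypothesis on `⊥` is needed only
for empty `S`, where there are no thresholds. -/
theorem le_of_forall_dist {v w : WithBot D.Dist} (hbot : w = ⊥ → v = ⊥)
    (h : ∀ s : D.S, w < (dist s : D.Dist) → v < (dist s : D.Dist)) : v ≤ w := by
  by_contra! hlt
  induction v using WithBot.recBotCoe with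
  | bot => exact not_lt_bot hlt
  | coe v =>
    induction w using WithBot.recBotCoe with
    | bot => exact WithBot.coe_ne_bot (hbot rfl)
    | coe w =>
      rcases isEmpty_or_nonempty D.S with hS | hS
      · have := D.subsingleton_dist
        rw [Subsingleton.elim v w] at hlt
        exact lt_irrefl _ hlt
      · obtain ⟨s, rfl⟩ := D.exists_eq_dist v
        exact lt_irrefl _ (h s hlt)

theorem eq_of_forall_dist {v w : WithBot D.Dist} (hbot : v = ⊥ ↔ w = ⊥)
    (h : ∀ s : D.S, v < (dist s : D.Dist) ↔ w < (dist s : D.Dist)) : v = w :=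
  le_antisymm (D.le_of_forall_dist hbot.2 fun s => (h s).2)
    (D.le_of_forall_dist hbot.1 fun s => (h s).1)

/-- An ultrametric with values in the distances, together with relations `P i`. -/
@[ext] structure UltraStr (X : Type*) where
  /-- the distance; it is `⊥` for equal points only -/
  d : X → X → WithBot D.Dist
  /-- the relations -/
  P : (i : Fin D.r) → (Fin (D.arity i) → X) → Prop
  d_eq_bot : ∀ {x y}, d x y = ⊥ ↔ x = y
  d_comm : ∀ x y, d x y = d y x
  d_le_max : ∀ x y z, d x z ≤ max (d x y) (d y z)
  P_comp : ∀ i, ∀ σ ∈ D.sym i, ∀ x, P i (x ∘ σ) ↔ P i x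
  P_injective : ∀ i x, P i x → Function.Injective x

variable {D} {X Y : Type*}

theorem UltraStr.d_self (N : D.UltraStr X) (x : X) : N.d x x = ⊥ := N.d_eq_bot.2 rfl

theorem UltraStr.d_le_of_le (N : D.UltraStr X) {x y z : X} {c : WithBot D.Dist} (h₁ : N.d x y ≤ c)
    (h₂ : N.d y z ≤ c) : N.d x z ≤ c :=
  (N.d_le_max x y z).trans (max_le h₁ h₂)

/-- Restriction of an ultrametric structure along an injective map. -/
def UltraStr.comap (N : D.UltraStr X) (f : Y → X) (hf : Function.Injective f) : D.UltraStr Y where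
  d x y := N.d (f x) (f y)
  P i x := N.P i (f ∘ x)
  d_eq_bot := N.d_eq_bot.trans hf.eq_iff
  d_comm _ _ := N.d_comm _ _
  d_le_max _ _ _ := N.d_le_max _ _ _
  P_comp i σ hσ x := N.P_comp i σ hσ (f ∘ x)
  P_injective i _ h := Function.Injective.of_comp (N.P_injective i _ h)

/-- The maps between ultrametric structures that preserve the distance and the relations in both
directions. -/
structure UltraStr.IsEmb (N : D.UltraStr X) (N' : D.UltraStr Y) (f : X → Y) : Prop where
  d_eq : ∀ x y, N'.d (f x) (f y) = N.d x y
  P_iff : ∀ i x, N'.P i (f ∘ x) ↔ N.P i x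

theorem UltraStr.IsEmb.injective {N : D.UltraStr X} {N' : D.UltraStr Y} {f : X → Y}
    (hf : N.IsEmb N' f) : Function.Injective f := fun _ _ h => by
  rw [← N.d_eq_bot, ← hf.d_eq, h, N'.d_self]

theorem UltraStr.IsEmb.comp {Z : Type*} {N : D.UltraStr X} {N' : D.UltraStr Y} {N'' : D.UltraStr Z}
    {f : X → Y} {g : Y → Z} (hg : N'.IsEmb N'' g) (hf : N.IsEmb N' f) : N.IsEmb N'' (g ∘ f) :=
  ⟨fun _ _ => (hg.d_eq _ _).trans (hf.d_eq _ _), fun i x => (hg.P_iff i _).trans (hf.P_iff i x)⟩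

theorem UltraStr.isEmb_comap (N : D.UltraStr X) (f : Y → X) (hf : Function.Injective f) :
    (N.comap f hf).IsEmb N f :=
  ⟨fun _ _ => rfl, fun _ _ => Iff.rfl⟩

/-! ### Translation between structures and ultrametric structures -/

/-- The first-order structure of an ultrametric structure. -/
@[reducible] def UltraStr.toStructure (N : D.UltraStr X) : D.language.Structure X where
  funMap f := isEmptyElim f
  RelMap {n} R x := match n, (R : D.Rel n), x with
    | _, Rel.E s, x => N.d (x 0) (x 1) < (dist s : D.Dist)
    | _, Rel.P i, x => N.P i x

theorem UltraStr.relE_toStructure (N : D.UltraStr X) (s : D.S) (x y : X) :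
    letI := N.toStructure
    D.relE s x y ↔ N.d x y < (dist s : D.Dist) := Iff.rfl

theorem UltraStr.isUStructure (N : D.UltraStr X) :
    letI := N.toStructure
    D.IsUStructure X := by
  let _ := N.toStructure
  refine ⟨N.P_comp, N.P_injective, fun s => ⟨fun x => ?_, fun {x y} h => ?_, fun {x y z} h h' => ?_⟩,
    fun s t hst x y h => ?_, fun hS x y hxy => ?_⟩
  · rw [N.relE_toStructure, N.d_self]
    exact WithBot.bot_lt_coe _
  · rw [N.relE_toStructure] at h ⊢
    rwa [N.d_comm]
  · rw [N.relE_toStructure] at h h' ⊢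
    exact (N.d_le_max x y z).trans_lt (max_lt h h')
  · rw [N.relE_toStructure] at h ⊢
    exact h.trans (WithBot.coe_lt_coe.2 (D.dist_lt_dist.2 hst))
  · have := hS.to_subtype
    obtain ⟨t, ht⟩ := WithBot.ne_bot_iff_exists.1 (mt N.d_eq_bot.1 hxy)
    obtain ⟨s, rfl⟩ := D.exists_eq_dist t
    have key : ∀ t : D.S, ¬ D.relE t x y ↔ t ≤ s := fun t => by
      rw [N.relE_toStructure, ← ht, not_lt, WithBot.coe_le_coe, D.dist_le_dist]
    exact ⟨s, (key s).2 le_rfl, fun t h => (key t).1 h⟩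

/-- By nestedness, `E t` fails exactly for the `t` up to the largest `s` at which it fails; that `s`
is the distance. -/
theorem exists_val_iff [D.language.Structure X] (hX : D.IsUStructure X) (x y : X) :
    ∃ v : WithBot D.Dist, (v = ⊥ ↔ x = y) ∧ ∀ s, D.relE s x y ↔ v < (dist s : D.Dist) := by
  by_cases hxy : x = y
  · exact ⟨⊥, by simp [hxy], fun s => by
      simpa [hxy, WithBot.bot_lt_coe] using (hX.equivalence s).refl y⟩
  · rcases isEmpty_or_nonempty D.S with hS | hS
    · exact ⟨(Classical.arbitrary D.Dist : D.Dist), by simp [hxy], fun s => isEmptyElim s⟩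
    · obtain ⟨s, hs, hmax⟩ := hX.exists_max (Set.nonempty_coe_sort.1 hS) x y hxy
      refine ⟨(dist s : D.Dist), by simp [hxy], fun t => ?_⟩
      rw [WithBot.coe_lt_coe, D.dist_lt_dist]
      constructor
      · intro h
        by_contra! hle
        rcases hle.lt_or_eq with hlt | rfl
        · exact hs (hX.nested _ _ hlt _ _ h)
        · exact hs h
      · intro hlt
        by_contra h
        exact (hmax h).not_gt hlt

open Classical in
/-- The ultrametric structure of a first-order structure. -/
noncomputable def IsUStructure.toUltraStr [D.language.Structure X] (hX : D.IsUStructure X) :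
    D.UltraStr X where
  d x y := (exists_val_iff hX x y).choose
  P i x := D.relP i x
  d_eq_bot {x y} := (exists_val_iff hX x y).choose_spec.1
  d_comm x y := D.eq_of_forall_dist
    (by rw [(exists_val_iff hX x y).choose_spec.1, (exists_val_iff hX y x).choose_spec.1, eq_comm])
    fun s => by
      rw [← (exists_val_iff hX x y).choose_spec.2, ← (exists_val_iff hX y x).choose_spec.2]
      exact ⟨(hX.equivalence s).symm, (hX.equivalence s).symm⟩
  d_le_max x y z := by
    refine D.le_of_forall_dist (fun h => ?_) fun s h => ?_
    · rw [max_eq_bot, (exists_val_iff hX x y).choose_spec.1,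
        (exists_val_iff hX y z).choose_spec.1] at h
      rw [(exists_val_iff hX x z).choose_spec.1, h.1, h.2]
    · rw [max_lt_iff, ← (exists_val_iff hX x y).choose_spec.2,
        ← (exists_val_iff hX y z).choose_spec.2] at h
      rw [← (exists_val_iff hX x z).choose_spec.2]
      exact (hX.equivalence s).trans h.1 h.2
  P_comp := hX.symmetric
  P_injective := hX.distinct

theorem IsUStructure.relE_iff [D.language.Structure X] (hX : D.IsUStructure X) (s : D.S) (x y : X) :
    D.relE s x y ↔ hX.toUltraStr.d x y < (dist s : D.Dist) :=
  (exists_val_iff hX x y).choose_spec.2 s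

section Embedding

variable [D.language.Structure X] [D.language.Structure Y]

theorem relE_embedding_iff (f : X ↪[D.language] Y) (s : D.S) (x y : X) :
    D.relE s (f x) (f y) ↔ D.relE s x y := by
  have := f.map_rel (Rel.E s : D.Rel 2) ![x, y]
  have hf : f ∘ ![x, y] = ![f x, f y] := by ext j; fin_cases j <;> rfl
  rwa [hf] at this

theorem relP_embedding_iff (f : X ↪[D.language] Y) (i : Fin D.r) (x : Fin (D.arity i) → X) :
    D.relP i (f ∘ x) ↔ D.relP i x :=
  f.map_rel (Rel.P i : D.Rel (D.arity i)) x

theorem isEmb_of_embedding (hX : D.IsUStructure X) (hY : D.IsUStructure Y) (f : X ↪[D.language] Y) :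
    hX.toUltraStr.IsEmb hY.toUltraStr f := by
  refine ⟨fun x y => D.eq_of_forall_dist ?_ fun s => ?_, relP_embedding_iff f⟩
  · rw [UltraStr.d_eq_bot, UltraStr.d_eq_bot, f.injective.eq_iff]
  · rw [← hY.relE_iff, ← hX.relE_iff, relE_embedding_iff]

/-- Maps that preserve the ultrametric structure are embeddings. -/
def embeddingOfIsEmb (hX : D.IsUStructure X) (hY : D.IsUStructure Y) {f : X → Y}
    (hf : hX.toUltraStr.IsEmb hY.toUltraStr f) : X ↪[D.language] Y where
  toFun := f
  inj' := hf.injective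
  map_fun' F := isEmptyElim F
  map_rel' {n} R x := by
    cases R with
    | E s =>
      have hx : x = ![x 0, x 1] := by ext j; fin_cases j <;> rfl
      have hfx : f ∘ x = ![f (x 0), f (x 1)] := by ext j; fin_cases j <;> rfl
      rw [hfx]
      nth_rewrite 3 [hx]
      show D.relE s _ _ ↔ D.relE s _ _
      rw [hY.relE_iff, hX.relE_iff, hf.d_eq]
    | P i => exact hf.P_iff i x

end Embedding

theorem UltraStr.toUltraStr_isUStructure (N : D.UltraStr X) :
    letI := N.toStructure
    N.isUStructure.toUltraStr = N := by
  let _ := N.toStructure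
  have hd : ∀ x y, N.isUStructure.toUltraStr.d x y = N.d x y := fun x y => by
    refine D.eq_of_forall_dist ?_ fun s => ?_
    · rw [UltraStr.d_eq_bot, UltraStr.d_eq_bot]
    · rw [← N.isUStructure.relE_iff, N.relE_toStructure]
  have : N.isUStructure.toUltraStr.d = N.d := funext fun x => funext fun y => hd x y
  exact UltraStr.ext this rfl

open FirstOrder

/-! ### Homogeneity and universality of the randomised ultrametric space -/

theorem exists_substructure (D : RandomisedUltrametricData) {U : Type*} [D.language.Structure U] (s : Set U) :
    ∃ S : D.language.Substructure U, (S : Set U) = s :=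
  ⟨⟨s, fun F => isEmptyElim F⟩, rfl⟩

section Universal

universe u

variable {D : RandomisedUltrametricData} {U : Type u} [Countable U] [D.language.Structure U]

/-- Each axiom concerns finitely many points at a time, hence can be checked in a finite
substructure, which belongs to the age. -/
theorem IsRandomisedUltrametricSpace.isUStructure (hU : D.IsRandomisedUltrametricSpace U) :
    D.IsUStructure U := by
  have key : ∀ s : Set U, s.Finite → ∃ (S : D.language.Substructure U), (S : Set U) = s ∧
      D.IsUStructure S := fun s hs => by
    obtain ⟨S, hS⟩ := D.exists_substructure s
    have : Finite S := (hS ▸ hs : (S : Set U).Finite).to_subtype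
    have h := Language.age.fg_substructure (L := D.language) (M := U) (S := S)
      Language.Substructure.FG.of_finite
    rw [hU.age] at h
    exact ⟨S, hS, h.2⟩
  have hE : ∀ (S : D.language.Substructure U) (s : D.S) (x y : S),
      D.relE s (x : U) (y : U) ↔ D.relE s x y := fun S => relE_embedding_iff S.subtype
  have hP : ∀ (S : D.language.Substructure U) (i : Fin D.r) (x : Fin (D.arity i) → S),
      D.relP i (fun j => (x j : U)) ↔ D.relP i x := fun S => relP_embedding_iff S.subtype
  refine ⟨fun i σ hσ x => ?_, fun i x h => ?_, fun s => ⟨fun x => ?_, fun {x y} h => ?_,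
    fun {x y z} h h' => ?_⟩, fun s t hst x y h => ?_, fun hS x y hxy => ?_⟩
  · obtain ⟨S, hS, h⟩ := key (Set.range x) (Set.finite_range x)
    have hx : ∀ j, x j ∈ S := fun j => by
      show x j ∈ (S : Set U); rw [hS]; exact ⟨j, rfl⟩
    have := h.symmetric i σ hσ fun j => ⟨x j, hx j⟩
    rwa [← hP, ← hP] at this
  · obtain ⟨S, hS, hS'⟩ := key (Set.range x) (Set.finite_range x)
    have hx : ∀ j, x j ∈ S := fun j => by
      show x j ∈ (S : Set U); rw [hS]; exact ⟨j, rfl⟩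
    have := hS'.distinct i (fun j => ⟨x j, hx j⟩) ((hP S i _).1 h)
    exact fun a b hab => this (Subtype.ext hab)
  · obtain ⟨S, hS, h⟩ := key {x} (Set.toFinite _)
    have hx : x ∈ S := by show x ∈ (S : Set U); simp [hS]
    exact (hE S s ⟨x, hx⟩ ⟨x, hx⟩).2 ((h.equivalence s).refl _)
  · obtain ⟨S, hS, hS'⟩ := key {x, y} (Set.toFinite _)
    have hx : x ∈ S := by show x ∈ (S : Set U); simp [hS]
    have hy : y ∈ S := by show y ∈ (S : Set U); simp [hS]
    exact (hE S s ⟨y, hy⟩ ⟨x, hx⟩).2 ((hS'.equivalence s).symm ((hE S s ⟨x, hx⟩ ⟨y, hy⟩).1 h))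
  · obtain ⟨S, hS, hS'⟩ := key {x, y, z} (Set.toFinite _)
    have hx : x ∈ S := by show x ∈ (S : Set U); simp [hS]
    have hy : y ∈ S := by show y ∈ (S : Set U); simp [hS]
    have hz : z ∈ S := by show z ∈ (S : Set U); simp [hS]
    exact (hE S s ⟨x, hx⟩ ⟨z, hz⟩).2 ((hS'.equivalence s).trans ((hE S s ⟨x, hx⟩ ⟨y, hy⟩).1 h)
      ((hE S s ⟨y, hy⟩ ⟨z, hz⟩).1 h'))
  · obtain ⟨S, hS, hS'⟩ := key {x, y} (Set.toFinite _)
    have hx : x ∈ S := by show x ∈ (S : Set U); simp [hS]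
    have hy : y ∈ S := by show y ∈ (S : Set U); simp [hS]
    exact (hE S t ⟨x, hx⟩ ⟨y, hy⟩).2 (hS'.nested s t hst _ _ ((hE S s ⟨x, hx⟩ ⟨y, hy⟩).1 h))
  · obtain ⟨S, hS', h⟩ := key {x, y} (Set.toFinite _)
    have hx : x ∈ S := by show x ∈ (S : Set U); simp [hS']
    have hy : y ∈ S := by show y ∈ (S : Set U); simp [hS']
    obtain ⟨s, hs⟩ := h.exists_max hS ⟨x, hx⟩ ⟨y, hy⟩ (fun h => hxy (congrArg Subtype.val h))
    refine ⟨s, ?_⟩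
    simpa only [← hE] using hs

/-- The ultrametric structure of the randomised ultrametric space. -/
noncomputable def IsRandomisedUltrametricSpace.ultraStr (hU : D.IsRandomisedUltrametricSpace U) :
    D.UltraStr U :=
  hU.isUStructure.toUltraStr

theorem IsRandomisedUltrametricSpace.isEmb (hU : D.IsRandomisedUltrametricSpace U)
    (g : U ≃[D.language] U) : hU.ultraStr.IsEmb hU.ultraStr g :=
  isEmb_of_embedding hU.isUStructure hU.isUStructure g.toEmbedding

theorem IsRandomisedUltrametricSpace.exists_isEmb (hU : D.IsRandomisedUltrametricSpace U)
    {B : Type u} [Finite B] (N : D.UltraStr B) : ∃ f : B → U, N.IsEmb hU.ultraStr f := by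
  let _ := N.toStructure
  have hB : CategoryTheory.Bundled.mk B N.toStructure ∈ D.language.age U := by
    rw [hU.age]
    exact ⟨‹Finite B›, N.isUStructure⟩
  obtain ⟨-, ⟨f⟩⟩ := hB
  refine ⟨f, ?_⟩
  have := isEmb_of_embedding N.isUStructure hU.isUStructure f
  rwa [N.toUltraStr_isUStructure] at this

theorem IsRandomisedUltrametricSpace.exists_equiv (hU : D.IsRandomisedUltrametricSpace U)
    {B : Type*} [Finite B] {e₁ e₂ : B → U}
    (hd : ∀ x y, hU.ultraStr.d (e₁ x) (e₁ y) = hU.ultraStr.d (e₂ x) (e₂ y))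
    (hP : ∀ i x, hU.ultraStr.P i (e₁ ∘ x) ↔ hU.ultraStr.P i (e₂ ∘ x)) :
    ∃ k : U ≃[D.language] U, ∀ x, k (e₁ x) = e₂ x := by
  obtain ⟨S, hS⟩ := D.exists_substructure (Set.range e₁)
  have hfin : Finite S := (hS ▸ Set.finite_range e₁ : (S : Set U).Finite).to_subtype
  have hex : ∀ x : S, ∃ b, e₁ b = x := fun x => (hS ▸ x.2 : (x : U) ∈ Set.range e₁)
  choose c hc using hex
  have hSU : D.IsUStructure S := by
    have h := Language.age.fg_substructure (L := D.language) (M := U) (S := S)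
      Language.Substructure.FG.of_finite
    rw [hU.age] at h
    exact h.2
  have hsub := isEmb_of_embedding hSU hU.isUStructure S.subtype
  have hcS : ∀ {n : ℕ} (x : Fin n → S), e₁ ∘ (c ∘ x) = S.subtype ∘ x := fun x =>
    funext fun j => hc (x j)
  have hf : hSU.toUltraStr.IsEmb hU.ultraStr (e₂ ∘ c) := by
    refine ⟨fun x y => ?_, fun i x => ?_⟩
    · show hU.ultraStr.d (e₂ (c x)) (e₂ (c y)) = _
      rw [← hd, hc, hc]
      exact hsub.d_eq x y
    · rw [Function.comp_assoc, ← hP, hcS]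
      exact hsub.P_iff i x
  obtain ⟨k, hk⟩ := hU.ultrahomogeneous S Language.Substructure.FG.of_finite
    (embeddingOfIsEmb hSU hU.isUStructure hf)
  refine ⟨k, fun b => ?_⟩
  have hb : e₁ b ∈ S := by show e₁ b ∈ (S : Set U); rw [hS]; exact ⟨b, rfl⟩
  have h1 : e₂ (c ⟨e₁ b, hb⟩) = k (e₁ b) :=
    congrArg (fun f : S ↪[D.language] U => f ⟨e₁ b, hb⟩) hk
  -- The map `e₁` need not be injective, but points it identifies are at distance `⊥` and are
  -- identified by `e₂` as well.
  rw [← h1, ← hU.ultraStr.d_eq_bot, ← hd, hU.ultraStr.d_eq_bot, hc]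

/-- A finite ultrametric structure can be embedded so that the embedding of a part is prescribed. -/
theorem IsRandomisedUltrametricSpace.exists_isEmb_extending
    (hU : D.IsRandomisedUltrametricSpace U) {B : Type u} {C : Type*} [Finite B] [Finite C]
    {N : D.UltraStr B} {N' : D.UltraStr C} {j : C → B} (hj : N'.IsEmb N j) {e : C → U}
    (he : N'.IsEmb hU.ultraStr e) :
    ∃ f : B → U, N.IsEmb hU.ultraStr f ∧ ∀ c, f (j c) = e c := by
  obtain ⟨f, hf⟩ := hU.exists_isEmb N
  obtain ⟨k, hk⟩ := hU.exists_equiv (e₁ := f ∘ j) (e₂ := e)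
    (fun x y => by rw [(hf.comp hj).d_eq, he.d_eq])
    (fun i x => by rw [(hf.comp hj).P_iff, he.P_iff])
  exact ⟨k ∘ f, (hU.isEmb k).comp hf, hk⟩

/-- Automorphisms of a finite substructure extend. -/
theorem IsRandomisedUltrametricSpace.exists_equiv_of_isEmb
    (hU : D.IsRandomisedUltrametricSpace U) {B : Type*} [Finite B] {N : D.UltraStr B} {f : B → U}
    (hf : N.IsEmb hU.ultraStr f) {σ : B → B} (hσ : N.IsEmb N σ) :
    ∃ k : U ≃[D.language] U, ∀ b, k (f b) = f (σ b) :=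
  hU.exists_equiv (e₁ := f) (e₂ := f ∘ σ) (fun x y => by rw [(hf.comp hσ).d_eq, hf.d_eq])
    (fun i x => by rw [(hf.comp hσ).P_iff, hf.P_iff])

end Universal

end RandomisedUltrametricData

/-! ### Tuples of automorphisms that commute on a finite set -/

section PartialTuples

variable {L : FirstOrder.Language} {M : Type*} [L.Structure M] {n : ℕ}

theorem IsInvariantUnder.bijOn {g : Fin n → (M ≃[L] M)} {A : Set M} (hg : IsInvariantUnder g A)
    (hA : A.Finite) (i : Fin n) : Set.BijOn (g i) A A :=
  (hA.injOn_iff_bijOn_of_mapsTo (hg i)).1 (g i).injective.injOn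

/-- A tuple of automorphisms that commutes on a finite invariant set `B`. -/
structure IsPartialCommutingTuple (B : Set M) (p : Fin n → (M ≃[L] M)) : Prop where
  finite : B.Finite
  invariant : IsInvariantUnder p B
  comm : ∀ i j, ∀ x ∈ B, p i (p j x) = p j (p i x)

theorem isPartialCommutingTuple_range {E : Type*} [Finite E] {φ : E → M} {σ : Fin n → E → E}
    {p : Fin n → (M ≃[L] M)} (hp : ∀ i u, p i (φ u) = φ (σ i u))
    (hσ : ∀ i j u, σ i (σ j u) = σ j (σ i u)) : IsPartialCommutingTuple (Set.range φ) p := by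
  refine ⟨Set.finite_range φ, ?_, ?_⟩
  · rintro i _ ⟨u, rfl⟩
    exact ⟨σ i u, (hp i u).symm⟩
  · rintro i j _ ⟨u, rfl⟩
    rw [hp, hp, hp, hp, hσ]

end PartialTuples

namespace RandomisedUltrametricData

/-! ### Free amalgams of ultrametric structures -/

section Amalgam

variable {D : RandomisedUltrametricData} {U E I : Type*}

/-- Two points of a family of extensions of `A` lie in a common extension. Here `F` maps the points
into an ambient structure and `π` indexes the extensions. -/
def Compatible (A : Finset U) (F : E → U) (π : E → I) (u v : E) : Prop :=
  F u ∈ A ∨ F v ∈ A ∨ π u = π v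

theorem Compatible.symm {A : Finset U} {F : E → U} {π : E → I} {u v : E}
    (h : Compatible A F π u v) : Compatible A F π v u := by
  rcases h with h | h | h
  exacts [Or.inr (Or.inl h), Or.inl h, Or.inr (Or.inr h.symm)]

theorem Compatible.refl (A : Finset U) (F : E → U) (π : E → I) (u : E) : Compatible A F π u u :=
  Or.inr (Or.inr rfl)

theorem Compatible.exists_index {A : Finset U} {F : E → U} {π : E → I} {u v : E}
    (h : Compatible A F π u v) : ∃ g, (π u = g ∨ F u ∈ A) ∧ (π v = g ∨ F v ∈ A) := by
  rcases h with h | h | h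
  exacts [⟨π v, Or.inr h, Or.inl rfl⟩, ⟨π u, Or.inl rfl, Or.inr h⟩, ⟨π u, Or.inl rfl, Or.inl h.symm⟩]

theorem compatible_of_index {A : Finset U} {F : E → U} {π : E → I} {u v : E} {g : I}
    (hu : π u = g ∨ F u ∈ A) (hv : π v = g ∨ F v ∈ A) : Compatible A F π u v := by
  rcases hu with hu | hu
  · rcases hv with hv | hv
    exacts [Or.inr (Or.inr (hu.trans hv.symm)), Or.inr (Or.inl hv)]
  · exact Or.inl hu

/-- An entry outside `A` determines the index of the common extension; if there is none, any index
will do. -/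
theorem Compatible.exists_index_of_forall {A : Finset U} {F : E → U} {π : E → I} {ι : Type*}
    [Nonempty ι] {x : ι → E} (h : ∀ j l, Compatible A F π (x j) (x l)) :
    ∃ g, ∀ j, π (x j) = g ∨ F (x j) ∈ A := by
  by_cases hj : ∃ j, F (x j) ∉ A
  · obtain ⟨j, hj⟩ := hj
    refine ⟨π (x j), fun l => ?_⟩
    rcases h l j with h | h | h
    exacts [Or.inr h, absurd h hj, Or.inl h]
  · push Not at hj
    exact ⟨π (x (Classical.arbitrary ι)), fun j => Or.inr (hj j)⟩

open Classical in
/-- The distance in the free amalgam: points that do not lie in a common extension are joined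
through `A`, but are never further apart than `s`. -/
noncomputable def amalgamDist (N : D.UltraStr U) (A : Finset U) (F : E → U) (π : E → I) (s : D.Dist)
    (u v : E) : WithBot D.Dist :=
  if Compatible A F π u v then N.d (F u) (F v)
  else A.fold min (s : WithBot D.Dist) fun a => max (N.d a (F u)) (N.d a (F v))

variable {N : D.UltraStr U} {A : Finset U} {F : E → U} {π : E → I} {s : D.Dist}

theorem amalgamDist_of_compatible {u v : E} (h : Compatible A F π u v) :
    amalgamDist N A F π s u v = N.d (F u) (F v) :=
  if_pos h

theorem amalgamDist_of_not_compatible {u v : E} (h : ¬ Compatible A F π u v) :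
    amalgamDist N A F π s u v =
      A.fold min (s : WithBot D.Dist) fun a => max (N.d a (F u)) (N.d a (F v)) :=
  if_neg h

/-- A description of the balls that is uniform in both cases of the definition: for compatible
points, the other two alternatives already force the distance in `N` to be at most `c`. The axioms
of the amalgam are verified through it. -/
theorem amalgamDist_le_iff (hs : ∀ u v, N.d (F u) (F v) ≤ s) {u v : E} {c : WithBot D.Dist} :
    amalgamDist N A F π s u v ≤ c ↔ s ≤ c ∨ (Compatible A F π u v ∧ N.d (F u) (F v) ≤ c) ∨
      ∃ a ∈ A, N.d a (F u) ≤ c ∧ N.d a (F v) ≤ c := by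
  have htri : (∃ a ∈ A, N.d a (F u) ≤ c ∧ N.d a (F v) ≤ c) → N.d (F u) (F v) ≤ c := by
    rintro ⟨a, -, h1, h2⟩
    exact N.d_le_of_le (N.d_comm a (F u) ▸ h1) h2
  by_cases h : Compatible A F π u v
  · rw [amalgamDist_of_compatible h]
    constructor
    · exact fun hc => Or.inr (Or.inl ⟨h, hc⟩)
    · rintro (hc | ⟨-, hc⟩ | hc)
      exacts [(hs u v).trans hc, hc, htri hc]
  · rw [amalgamDist_of_not_compatible h, Finset.fold_min_le]
    simp [h]

/-- The free amalgam of a family of extensions of `A`. -/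
noncomputable def amalgam (N : D.UltraStr U) (A : Finset U) (F : E → U) (π : E → I) (s : D.Dist)
    (hs : ∀ u v, N.d (F u) (F v) ≤ s)
    (hinj : ∀ u v, Compatible A F π u v → F u = F v → u = v) : D.UltraStr E where
  d := amalgamDist N A F π s
  P i x := (∀ j l, Compatible A F π (x j) (x l)) ∧ N.P i (F ∘ x)
  d_eq_bot {u v} := by
    rw [← le_bot_iff, amalgamDist_le_iff hs, le_bot_iff]
    simp only [WithBot.coe_ne_bot, false_or, le_bot_iff, N.d_eq_bot]
    constructor
    · rintro (h | ⟨a, ha, h1, h2⟩)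
      · exact hinj u v h.1 h.2
      · exact hinj u v (Or.inl (h1 ▸ ha)) (h1.symm.trans h2)
    · rintro rfl
      exact Or.inl ⟨Compatible.refl _ _ _ _, rfl⟩
  d_comm u v := by
    refine eq_of_forall_ge_iff fun c => ?_
    have h1 : Compatible A F π u v ↔ Compatible A F π v u := ⟨.symm, .symm⟩
    rw [amalgamDist_le_iff hs, amalgamDist_le_iff hs, h1, N.d_comm (F u)]
    simp only [and_comm]
  d_le_max u v w := by
    have h1 := (amalgamDist_le_iff hs).1 (le_max_left (amalgamDist N A F π s u v)
      (amalgamDist N A F π s v w))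
    have h2 := (amalgamDist_le_iff hs).1 (le_max_right (amalgamDist N A F π s u v)
      (amalgamDist N A F π s v w))
    generalize max (amalgamDist N A F π s u v) (amalgamDist N A F π s v w) = c at h1 h2
    rw [amalgamDist_le_iff hs]
    rcases h1 with h1 | ⟨huv, h1⟩ | ⟨a, ha, h1, h1'⟩
    · exact Or.inl h1
    · rcases h2 with h2 | ⟨hvw, h2⟩ | ⟨b, hb, h2, h2'⟩
      · exact Or.inl h2
      -- If the middle point lies over `A`, it serves as the connecting point. Otherwise it
      -- determines its extension, and the outer points are compatible.
      · by_cases hv : F v ∈ A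
        · exact Or.inr (Or.inr ⟨F v, hv, N.d_comm (F u) (F v) ▸ h1, h2⟩)
        · refine Or.inr (Or.inl ⟨?_, N.d_le_of_le h1 h2⟩)
          rcases huv with h | h | h
          · exact Or.inl h
          · exact absurd h hv
          · rcases hvw with h' | h' | h'
            exacts [absurd h' hv, Or.inr (Or.inl h'), Or.inr (Or.inr (h.trans h'))]
      · exact Or.inr (Or.inr ⟨b, hb, N.d_le_of_le h2 (N.d_comm (F u) (F v) ▸ h1), h2'⟩)
    · rcases h2 with h2 | ⟨hvw, h2⟩ | ⟨b, hb, h2, h2'⟩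
      · exact Or.inl h2
      · exact Or.inr (Or.inr ⟨a, ha, h1, N.d_le_of_le h1' h2⟩)
      · exact Or.inr (Or.inr ⟨a, ha, h1,
          N.d_le_of_le (N.d_le_of_le h1' (N.d_comm b (F v) ▸ h2)) h2'⟩)
  P_comp i σ hσ x := by
    refine and_congr ⟨fun h j l => ?_, fun h j l => h _ _⟩ (N.P_comp i σ hσ (F ∘ x))
    have := h (σ.symm j) (σ.symm l)
    simpa using this
  P_injective i x h := Function.Injective.of_comp (N.P_injective i _ h.2)

theorem amalgam_P_iff (hs : ∀ u v, N.d (F u) (F v) ≤ s)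
    (hinj : ∀ u v, Compatible A F π u v → F u = F v → u = v) {i : Fin D.r}
    {x : Fin (D.arity i) → E} (hx : ∀ j l, Compatible A F π (x j) (x l)) :
    (amalgam N A F π s hs hinj).P i x ↔ N.P i (F ∘ x) :=
  and_iff_right hx

/-- Distances and relations of the amalgam are computed inside one extension or from distances to
`A`. It therefore suffices that `σ` permutes the extensions and is, on each of them, induced by an
embedding restricting to the same bijection `τ` of `A`. -/
theorem amalgam_isEmb (hs : ∀ u v, N.d (F u) (F v) ≤ s)
    (hinj : ∀ u v, Compatible A F π u v → F u = F v → u = v) {σ : E → E} {τ : U → U}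
    (hτ : Set.BijOn τ A A) (hσ : ∀ u v, F u ∉ A → F v ∉ A → (π (σ u) = π (σ v) ↔ π u = π v))
    (hk : ∀ g, ∃ k : U → U, N.IsEmb N k ∧ (∀ a ∈ A, k a = τ a) ∧
      ∀ u, (π u = g ∨ F u ∈ A) → F (σ u) = k (F u)) :
    (amalgam N A F π s hs hinj).IsEmb (amalgam N A F π s hs hinj) σ := by
  have hmem : ∀ u, F (σ u) ∈ A ↔ F u ∈ A := fun u => by
    obtain ⟨k, hkN, hkA, hkF⟩ := hk (π u)
    rw [hkF u (Or.inl rfl)]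
    constructor
    · intro h
      obtain ⟨a, ha, hau⟩ := hτ.surjOn h
      rw [← hkA a ha] at hau
      exact hkN.injective hau ▸ ha
    · intro h
      rw [hkA _ h]
      exact hτ.mapsTo h
  have hcompat : ∀ u v, Compatible A F π (σ u) (σ v) ↔ Compatible A F π u v := fun u v => by
    simp only [Compatible, hmem]
    by_cases hu : F u ∈ A
    · simp [hu]
    by_cases hv : F v ∈ A
    · simp [hv]
    rw [hσ u v hu hv]
  refine ⟨fun u v => ?_, fun i x => ?_⟩
  · show amalgamDist N A F π s _ _ = amalgamDist N A F π s _ _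
    by_cases h : Compatible A F π u v
    · rw [amalgamDist_of_compatible h, amalgamDist_of_compatible ((hcompat u v).2 h)]
      obtain ⟨g, hu, hv⟩ := h.exists_index
      obtain ⟨k, hkN, -, hkF⟩ := hk g
      rw [hkF u hu, hkF v hv, hkN.d_eq]
    · rw [amalgamDist_of_not_compatible h, amalgamDist_of_not_compatible (mt (hcompat u v).1 h)]
      have hd : ∀ a ∈ A, ∀ w, N.d (τ a) (F (σ w)) = N.d a (F w) := fun a ha w => by
        obtain ⟨k, hkN, hkA, hkF⟩ := hk (π w)
        rw [hkF w (Or.inl rfl), ← hkA a ha, hkN.d_eq]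
      refine eq_of_forall_le_iff fun c => ?_
      rw [Finset.le_fold_min, Finset.le_fold_min]
      refine and_congr_right fun _ => ⟨fun h a ha => ?_, fun h a ha => ?_⟩
      · have := h (τ a) (hτ.mapsTo ha)
        rwa [hd a ha, hd a ha] at this
      · obtain ⟨b, hb, rfl⟩ := hτ.surjOn ha
        rw [hd b hb, hd b hb]
        exact h b hb
  · refine Iff.trans (and_congr_left' (forall₂_congr fun j l => hcompat (x j) (x l)))
      (and_congr_right fun h => ?_)
    have : Nonempty (Fin (D.arity i)) := ⟨⟨0, D.arity_pos i⟩⟩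
    obtain ⟨g, hg⟩ := Compatible.exists_index_of_forall h
    obtain ⟨k, hkN, -, hkF⟩ := hk g
    have : F ∘ σ ∘ x = k ∘ F ∘ x := funext fun j => hkF (x j) (hg j)
    rw [this]
    exact hkN.P_iff i _

theorem exists_dist_bound [Finite E] (N : D.UltraStr U) (F : E → U) :
    ∃ s : D.Dist, ∀ u v, N.d (F u) (F v) ≤ s := by
  obtain ⟨b, hb⟩ := (Set.finite_range fun p : E × E => N.d (F p.1) (F p.2)).bddAbove
  have hb' : ∀ u v, N.d (F u) (F v) ≤ b := fun u v => hb ⟨(u, v), rfl⟩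
  induction b using WithBot.recBotCoe with
  | bot => exact ⟨Classical.arbitrary _, fun u v => (hb' u v).trans bot_le⟩
  | coe s => exact ⟨s, hb'⟩

end Amalgam

/-! ### Extending and amalgamating finite pieces of commuting tuples -/

section Pieces

universe u

variable {D : RandomisedUltrametricData} {U : Type u} [Countable U] [D.language.Structure U] {n : ℕ}

/-- A family of extensions of `A` inside `U`, given by `F` and `π`, can be realised in `U` freely
over `A`, with one of the extensions left in place and with symmetries of the family extended to
automorphisms. -/
theorem IsRandomisedUltrametricSpace.exists_amalgam (hU : D.IsRandomisedUltrametricSpace U)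
    {E : Type u} {I : Type*} [Finite E] {A : Finset U} {F : E → U} {π : E → I}
    (hinj : ∀ u v, Compatible A F π u v → F u = F v → u = v) (g₀ : I) (σ : Fin n → E → E)
    (τ : Fin n → (U ≃[D.language] U)) (hτ : IsInvariantUnder τ (A : Set U))
    (hσ : ∀ i u v, F u ∉ A → F v ∉ A → (π (σ i u) = π (σ i v) ↔ π u = π v))
    (hk : ∀ i g, ∃ k : U ≃[D.language] U, (∀ a ∈ A, k a = τ i a) ∧
      ∀ u, (π u = g ∨ F u ∈ A) → F (σ i u) = k (F u)) :
    ∃ (φ : E → U) (p : Fin n → (U ≃[D.language] U)),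
      (∀ u, (π u = g₀ ∨ F u ∈ A) → φ u = F u) ∧ (∀ i u, p i (φ u) = φ (σ i u)) ∧
      ∀ {B : Type u} [Finite B] (j : B → E), (∀ b c, Compatible A F π (j b) (j c)) →
        ∃ k : U ≃[D.language] U, ∀ b, k (F (j b)) = φ (j b) := by
  obtain ⟨s, hs⟩ := exists_dist_bound hU.ultraStr F
  let N := amalgam hU.ultraStr A F π s hs hinj
  have hemb : ∀ {B : Type u} (j : B → E) (hj : Function.Injective j),
      (∀ b c, Compatible A F π (j b) (j c)) →
        (N.comap j hj).IsEmb hU.ultraStr (F ∘ j) := fun j hj hc =>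
    ⟨fun b c => (amalgamDist_of_compatible (hc b c)).symm, fun i x =>
      (amalgam_P_iff hs hinj (x := j ∘ x) fun _ _ => hc _ _).symm⟩
  obtain ⟨φ, hφ, hφF⟩ := hU.exists_isEmb_extending
    (N.isEmb_comap (Subtype.val : {u // π u = g₀ ∨ F u ∈ A} → E) Subtype.val_injective)
    (hemb Subtype.val Subtype.val_injective fun b c => compatible_of_index b.2 c.2)
  have haut : ∀ i, N.IsEmb N (σ i) := fun i =>
    amalgam_isEmb hs hinj (hτ.bijOn A.finite_toSet i) (hσ i) fun g => by
      obtain ⟨k, hk⟩ := hk i g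
      exact ⟨k, hU.isEmb k, hk⟩
  choose p hp using fun i => hU.exists_equiv_of_isEmb hφ (haut i)
  refine ⟨φ, p, fun u hu => hφF ⟨u, hu⟩, hp, fun j hj => ?_⟩
  refine hU.exists_equiv (fun b c => ?_) (fun i x => ?_)
  · show _ = hU.ultraStr.d (φ (j b)) (φ (j c))
    rw [hφ.d_eq]
    exact (amalgamDist_of_compatible (hj b c)).symm
  · show _ ↔ hU.ultraStr.P i (φ ∘ j ∘ x)
    rw [hφ.P_iff]
    exact (amalgam_P_iff hs hinj (x := j ∘ x) fun _ _ => hj _ _).symm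

/-- Let G be the finite set of permutations of `B` induced by automorphisms. One copy of `X \ B`,
its image under a chosen lift of γ, is attached for each γ in G, freely over `B`. Left
multiplication by the permutation that `p i` induces on `B` moves the copies, leaving the label in
`X \ B` alone; these motions commute because the `p i` commute on `B`. -/
theorem _root_.IsPartialCommutingTuple.exists_extension_superset
    (hU : D.IsRandomisedUltrametricSpace U) {B : Set U} {p : Fin n → (U ≃[D.language] U)}
    (hp : IsPartialCommutingTuple B p) {X : Set U} (hX : X.Finite) :
    ∃ (B' : Set U) (p' : Fin n → (U ≃[D.language] U)), IsPartialCommutingTuple B' p' ∧ B ⊆ B' ∧ X ⊆ B' ∧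
      ∀ i, ∀ x ∈ B, p' i x = (p i x : U) := by
  classical
  obtain ⟨hB, hinv, hcomm⟩ := hp
  lift B to Finset U using hB
  let G := {γ : Equiv.Perm B // ∃ k : U ≃[D.language] U, ∀ b : B, k b = (γ b : U)}
  let lft : G → (U ≃[D.language] U) := fun γ => γ.2.choose
  have hlft : ∀ (γ : G) (b : B), lft γ b = (γ.1 b : U) := fun γ => γ.2.choose_spec
  have hlft_mem : ∀ (γ : G) (x : U), lft γ x ∈ B → x ∈ B := fun γ x hx => by
    have h1 := hlft γ (γ.1.symm ⟨_, hx⟩)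
    rw [Equiv.apply_symm_apply] at h1
    rw [← (lft γ).injective h1]
    exact (γ.1.symm ⟨_, hx⟩).2
  have hbij : ∀ i, Function.Bijective fun b : B => (⟨p i b, hinv i b b.2⟩ : B) := fun i =>
    Finite.injective_iff_bijective.1 fun b c h =>
      Subtype.ext ((p i).injective (congrArg Subtype.val h))
  let pB : Fin n → Equiv.Perm B := fun i => Equiv.ofBijective _ (hbij i)
  let act : Fin n → G → G := fun i γ => ⟨pB i * γ.1, p i * lft γ, fun b => by
    rw [autGroup_mul_apply, hlft]; rfl⟩
  have hact : ∀ i γ γ', act i γ = act i γ' ↔ γ = γ' := fun i γ γ' => by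
    rw [Subtype.ext_iff, Subtype.ext_iff]
    exact mul_right_inj _
  let g₀ : G := ⟨1, 1, fun _ => rfl⟩
  let Y := (hX.toFinset \ B : Finset U)
  have hY : ∀ y : Y, (y : U) ∉ B := fun y => (Finset.mem_sdiff.1 y.2).2
  let F : B ⊕ (G × Y) → U := Sum.elim Subtype.val fun q => lft q.1 q.2
  let π : B ⊕ (G × Y) → G := Sum.elim (fun _ => g₀) Prod.fst
  let σ : Fin n → B ⊕ (G × Y) → B ⊕ (G × Y) := fun i =>
    Sum.map (pB i) fun q => (act i q.1, q.2)
  have hFr : ∀ q, F (Sum.inr q) ∉ B := fun q h => hY q.2 (hlft_mem _ _ h)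
  -- The chosen lift of the identity permutation fixes `B` pointwise but may move `X \ B`, whence
  -- the conjugation by it at the end.
  have hfix : ∀ b : B, (lft g₀)⁻¹ b = (b : U) := fun b => by
    have := hlft g₀ b
    nth_rewrite 1 [← show lft g₀ b = (b : U) from this]
    simp
  obtain ⟨φ, p', hφ, hp', -⟩ := hU.exists_amalgam (A := B) (F := F) (π := π)
    (by
      rintro (b | ⟨γ, y⟩) (c | ⟨δ, z⟩) hc h
      · exact congrArg Sum.inl (Subtype.ext h)
      · exact absurd (h ▸ b.2 : F (Sum.inr (δ, z)) ∈ B) (hFr _)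
      · exact absurd (h ▸ c.2 : F (Sum.inr (γ, y)) ∈ B) (hFr _)
      · have : γ = δ := (hc.resolve_left (hFr _)).resolve_left (hFr _)
        subst this
        have hyz : y = z := Subtype.ext ((lft γ).injective h)
        rw [hyz])
    g₀ σ p hinv
    (by
      rintro i (b | q) (c | q') hu hv
      · exact absurd b.2 hu
      · exact absurd b.2 hu
      · exact absurd c.2 hv
      · exact hact i q.1 q'.1)
    (by
      intro i γ
      -- The motion from copy γ to its successor is the quotient of the two lifts, which restricts
      -- to `p i` on `B` whatever lifts were chosen.
      have hk : ∀ b : B, (lft (act i γ) * (lft γ)⁻¹) b = p i b := fun b => by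
        obtain ⟨c, rfl⟩ := γ.1.surjective b
        rw [autGroup_mul_apply, ← hlft, autGroup_inv_apply_self, hlft, hlft]
        rfl
      refine ⟨lft (act i γ) * (lft γ)⁻¹, fun a ha => hk ⟨a, ha⟩, ?_⟩
      rintro (b | ⟨δ, y⟩) hu
      · exact (hk b).symm
      · obtain rfl : δ = γ := hu.resolve_right (hFr _)
        simp [F, σ])
  have hφB : ∀ b : B, φ (Sum.inl b) = b := fun b => hφ (Sum.inl b) (Or.inr b.2)
  have hφY : ∀ y : Y, φ (Sum.inr (g₀, y)) = lft g₀ y := fun y =>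
    hφ (Sum.inr (g₀, y)) (Or.inl rfl)
  refine ⟨Set.range fun u => (lft g₀)⁻¹ (φ u), fun i => (lft g₀)⁻¹ * p' i * lft g₀,
    isPartialCommutingTuple_range (σ := σ) (fun i u => by simp [hp']) (fun i j u => ?_),
    fun b hb => ?_, fun x hx => ?_, fun i x hx => ?_⟩
  · have hc : ∀ b, pB i (pB j b) = pB j (pB i b) := fun b => Subtype.ext (hcomm i j b b.2)
    rcases u with b | ⟨γ, y⟩
    · exact congrArg Sum.inl (hc b)
    · have : act i (act j γ) = act j (act i γ) := Subtype.ext (Equiv.ext fun b => hc _)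
      simp [σ, this]
  · refine ⟨Sum.inl ⟨b, hb⟩, ?_⟩
    exact (congrArg _ (hφB _)).trans (hfix ⟨b, hb⟩)
  · by_cases hxB : x ∈ B
    · refine ⟨Sum.inl ⟨x, hxB⟩, ?_⟩
      exact (congrArg _ (hφB _)).trans (hfix ⟨x, hxB⟩)
    · refine ⟨Sum.inr (g₀, ⟨x, Finset.mem_sdiff.2 ⟨hX.mem_toFinset.2 hx, hxB⟩⟩), ?_⟩
      exact (congrArg _ (hφY _)).trans (autGroup_inv_apply_self _ _)
  · have h1 : lft g₀ x = x := hlft g₀ ⟨x, hx⟩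
    have h2 := hp' i (Sum.inl ⟨x, hx⟩)
    rw [hφB] at h2
    replace h2 := h2.trans (hφB _)
    rw [autGroup_mul_apply, autGroup_mul_apply, h1]
    exact (congrArg _ h2).trans (hfix ⟨p i x, hinv i x hx⟩)

theorem _root_.IsPartialCommutingTuple.exists_commutingTuple
    (hU : D.IsRandomisedUltrametricSpace U) {B : Set U} {p : Fin n → (U ≃[D.language] U)}
    (hp : IsPartialCommutingTuple B p) :
    ∃ r ∈ commutingTuples n (U ≃[D.language] U), ∀ i, ∀ x ∈ B, r i x = p i x := by
  obtain ⟨r, hr, hlim⟩ := exists_limit_of_extension IsPartialCommutingTuple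
    (fun A k hk F hF => by
      obtain ⟨B', p', h, hA, hX, hpp'⟩ := hk.exists_extension_superset hU hF
      exact ⟨B', p', h, hA, hX, fun i => by rwa [(h.invariant.bijOn h.finite i).image_eq], hpp'⟩)
    B p hp
  refine ⟨r, fun i j => FirstOrder.Language.Equiv.ext fun x => ?_, hr⟩
  obtain ⟨A, k, hk, hx, hkr⟩ := hlim {x} (Set.finite_singleton x)
  rw [Set.singleton_subset_iff] at hx
  rw [autGroup_mul_apply, autGroup_mul_apply, hkr j x hx, hkr i x hx,
    hkr i _ (hk.invariant j x hx), hkr j _ (hk.invariant i x hx)]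
  exact hk.comm i j x hx

/-- The piece on `C` stays in place and `B \ A` is moved to a position free from `C` over `A`. There
`p` and `q` glue to a partial commuting tuple, which extends. -/
theorem IsRandomisedUltrametricSpace.hasTupleAmalgamation
    (hU : D.IsRandomisedUltrametricSpace U) (n : ℕ) : HasTupleAmalgamation D.language U n := by
  classical
  intro p hp q hq A B C hB hC hAB hAC hpA hpB hqC hpq
  have hA := hB.subset hAB
  have hpA' : ∀ i x, p i x ∈ A → x ∈ A := fun i x hx => by
    obtain ⟨a, ha, hax⟩ := (hpA.bijOn hA i).surjOn hx
    exact (p i).injective hax ▸ ha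
  lift B to Finset U using hB
  lift C to Finset U using hC
  lift A to Finset U using hA
  let F : C ⊕ (B \ A : Finset U) → U := Sum.elim Subtype.val Subtype.val
  let π : C ⊕ (B \ A : Finset U) → Bool := Sum.elim (fun _ => true) fun _ => false
  have hr : ∀ b : (B \ A : Finset U), (b : U) ∈ B ∧ (b : U) ∉ A := fun b => Finset.mem_sdiff.1 b.2
  let σ : Fin n → C ⊕ (B \ A : Finset U) → C ⊕ (B \ A : Finset U) := fun i =>
    Sum.map (fun c => ⟨q i c, hqC i c c.2⟩) fun b =>
      ⟨p i b, Finset.mem_sdiff.2 ⟨hpB i b (hr b).1, fun h => (hr b).2 (hpA' i b h)⟩⟩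
  obtain ⟨φ, r, hφ, hrφ, hpiece⟩ := hU.exists_amalgam (A := A) (F := F) (π := π)
    (by
      rintro (c | b) (c' | b') hc h
      · exact congrArg Sum.inl (Subtype.ext h)
      · rcases hc with hc | hc | hc
        · exact absurd (h ▸ hc : F (Sum.inr b') ∈ A) (hr b').2
        · exact absurd hc (hr b').2
        · cases hc
      · rcases hc with hc | hc | hc
        · exact absurd hc (hr b).2
        · exact absurd (h ▸ hc : F (Sum.inr b) ∈ A) (hr b).2
        · cases hc
      · exact congrArg Sum.inr (Subtype.ext h))
    true σ p hpA
    (by rintro i (c | b) (c' | b') - - <;> exact Iff.rfl)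
    (by
      rintro i (_ | _)
      · refine ⟨p i, fun _ _ => rfl, ?_⟩
        rintro (c | b) hu
        · rcases hu with hu | hu
          · cases hu
          · exact (hpq i c hu).symm
        · rfl
      · refine ⟨q i, fun a ha => (hpq i a ha).symm, ?_⟩
        rintro (c | b) hu
        · rfl
        · rcases hu with hu | hu
          · cases hu
          · exact absurd hu (hr b).2)
  let j : B → C ⊕ (B \ A : Finset U) := fun b =>
    if h : (b : U) ∈ A then Sum.inl ⟨b, hAC h⟩ else Sum.inr ⟨b, Finset.mem_sdiff.2 ⟨b.2, h⟩⟩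
  have hjA : ∀ (b : B) (h : (b : U) ∈ A), j b = Sum.inl ⟨b, hAC h⟩ := fun b h => dif_pos h
  have hjB : ∀ (b : B) (h : (b : U) ∉ A), j b = Sum.inr ⟨b, Finset.mem_sdiff.2 ⟨b.2, h⟩⟩ :=
    fun b h => dif_neg h
  have hFj : ∀ b, F (j b) = b := fun b => by
    by_cases h : (b : U) ∈ A
    · rw [hjA b h]; rfl
    · rw [hjB b h]; rfl
  have hσj : ∀ i b, σ i (j b) = j ⟨p i b, hpB i b b.2⟩ := fun i b => by
    by_cases h : (b : U) ∈ A
    · rw [hjA b h, hjA _ (hpA i b h)]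
      exact congrArg Sum.inl (Subtype.ext (hpq i b h).symm)
    · rw [hjB b h, hjB _ (fun h' => h (hpA' i b h'))]
      rfl
  obtain ⟨k, hk⟩ := hpiece j fun b c => by
    by_cases hb : (b : U) ∈ A
    · exact Or.inl ((hFj b).symm ▸ hb)
    by_cases hc : (c : U) ∈ A
    · exact Or.inr (Or.inl ((hFj c).symm ▸ hc))
    · rw [hjB b hb, hjB c hc]
      exact Or.inr (Or.inr rfl)
  have hk' : ∀ b : B, k b = φ (j b) := fun b => by rw [← hk, hFj]
  have hφC : ∀ c : C, φ (Sum.inl c) = c := fun c => hφ _ (Or.inl rfl)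
  obtain ⟨r', hr', hrr'⟩ := (isPartialCommutingTuple_range hrφ (fun i l u => by
    rcases u with c | b
    · exact congrArg Sum.inl (Subtype.ext (congrArg (fun f : U ≃[D.language] U => f c) (hq i l)))
    · exact congrArg Sum.inr
        (Subtype.ext (congrArg (fun f : U ≃[D.language] U => f b) (hp i l))))).exists_commutingTuple
      hU
  refine ⟨k, r', hr', fun x hx => ?_, fun i x hx => ?_, fun i x hx => ?_⟩
  · rw [hk' ⟨x, hAB hx⟩, hjA _ hx, hφC]
  · have := hrφ i (Sum.inl ⟨x, hx⟩)
    rw [hrr' i x ⟨_, hφC ⟨x, hx⟩⟩]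
    rw [hφC] at this
    exact this.trans (hφC _)
  · rw [hk' ⟨x, hx⟩, hrr' i _ ⟨_, rfl⟩, hrφ, hσj, ← hk']

end Pieces

end RandomisedUltrametricData

/-! ### Separability of subgroups of finitely generated abelian groups -/

section Separability

/-- By the structure theorem there are two cases. If the free part of x vanishes, an m killing the
torsion works. Otherwise m exceeds the absolute value of a nonzero free coordinate of x, so it does
not divide that coordinate. -/
theorem AddCommGroup.exists_nsmul_ne {Q : Type*} [AddCommGroup Q] [AddGroup.FG Q] {x : Q}
    (hx : x ≠ 0) : ∃ m : ℕ, 0 < m ∧ ∀ y : Q, m • y ≠ x := by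
  classical
  obtain ⟨n, ι, _, p, hp, e, ⟨f⟩⟩ := AddCommGroup.equiv_free_prod_directSum_zmod Q
  by_cases h1 : (f x).1 = 0
  · refine ⟨∏ i, p i ^ e i, Finset.prod_pos fun i _ => pow_pos (hp i).pos _, ?_⟩
    rintro y rfl
    refine hx (f.injective ?_)
    rw [map_zero]
    refine Prod.ext h1 (DFinsupp.ext fun i => ?_)
    obtain ⟨c, hc⟩ := Finset.dvd_prod_of_mem (fun i => p i ^ e i) (Finset.mem_univ i)
    rw [map_nsmul, Prod.smul_snd]
    show (∏ i, p i ^ e i) • ((f y).2 i) = 0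
    rw [hc, nsmul_eq_mul, Nat.cast_mul, ZMod.natCast_self, zero_mul, zero_mul]
  · obtain ⟨j, hj⟩ := Finsupp.ne_iff.1 h1
    refine ⟨((f x).1 j).natAbs + 1, Nat.succ_pos _, fun y hy => hj ?_⟩
    refine Int.eq_zero_of_abs_lt_dvd (m := ((((f x).1 j).natAbs + 1 : ℕ) : ℤ)) ⟨(f y).1 j, ?_⟩ ?_
    · nth_rewrite 1 [← hy]
      rw [map_nsmul, Prod.smul_fst, Finsupp.smul_apply, nsmul_eq_mul]
    · push_cast
      omega

/-- Separability: a coset of K other than K itself avoids the m-th powers for some m > 0, by the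
previous lemma in Γ/K. -/
theorem Subgroup.exists_pow_notMem {Γ : Type*} [CommGroup Γ] [Group.FG Γ] (K : Subgroup Γ) {a : Γ}
    (ha : a ∉ K) : ∃ m : ℕ, 0 < m ∧ ∀ y : Γ, a⁻¹ * y ^ m ∉ K := by
  have hx : Additive.ofMul (a : Γ ⧸ K) ≠ 0 := fun h =>
    ha ((QuotientGroup.eq_one_iff a).1 (Additive.ofMul.injective h))
  obtain ⟨m, hm, h⟩ := AddCommGroup.exists_nsmul_ne hx
  refine ⟨m, hm, fun y hy => h (Additive.ofMul (y : Γ ⧸ K)) ?_⟩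
  exact (congrArg Additive.ofMul (QuotientGroup.eq.2 hy)).symm

theorem exists_pos_forall_of_finite {ι : Type*} [Finite ι] {p : ι → ℕ → Prop}
    (h : ∀ i, ∃ m, 0 < m ∧ p i m) (hmul : ∀ i m c, p i m → p i (m * c)) :
    ∃ m, 0 < m ∧ ∀ i, p i m := by
  classical
  have := Fintype.ofFinite ι
  choose m hm hp using h
  refine ⟨∏ i, m i, Finset.prod_pos fun i _ => hm i, fun i => ?_⟩
  obtain ⟨c, hc⟩ := Finset.dvd_prod_of_mem m (Finset.mem_univ i)
  rw [hc]
  exact hmul i _ c (hp i)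

end Separability

namespace RandomisedUltrametricData

/-! ### Quotients of ultrametric structures -/

section Quotient

variable {D : RandomisedUltrametricData} {U Q : Type*}

open Classical in
/-- The distance in a quotient `mk`: the least element of `T` that bounds the distance of some
representatives, or `s` if there is none. -/
noncomputable def quotientDist (N : D.UltraStr U) (mk : U → Q) (T : Finset (WithBot D.Dist))
    (s : D.Dist) (p q : Q) : WithBot D.Dist :=
  if p = q then ⊥
  else (T.filter fun t => ∃ x y, mk x = p ∧ mk y = q ∧ N.d x y ≤ t).fold min (s : WithBot D.Dist) id

variable {N : D.UltraStr U} {mk : U → Q} {T : Finset (WithBot D.Dist)} {s : D.Dist}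

/-- The distances between representatives need not have a least element; rounding up into the finite
set `T`, capped by `s`, makes the minimum exist. -/
theorem quotientDist_le_iff {p q : Q} {c : WithBot D.Dist} :
    quotientDist N mk T s p q ≤ c ↔ p = q ∨ s ≤ c ∨
      ∃ t ∈ T, t ≤ c ∧ ∃ x y, mk x = p ∧ mk y = q ∧ N.d x y ≤ t := by
  classical
  rw [quotientDist]
  split_ifs with h
  · simp [h]
  · rw [Finset.fold_min_le]
    simp only [Finset.mem_filter, id, h, false_or]
    constructor
    · rintro (h | ⟨t, ⟨ht, h⟩, htc⟩)
      exacts [Or.inl h, Or.inr ⟨t, ht, htc, h⟩]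
    · rintro (h | ⟨t, ht, htc, h⟩)
      exacts [Or.inl h, Or.inr ⟨t, ⟨ht, h⟩, htc⟩]

theorem quotientDist_eq_bot_iff (hT : ⊥ ∉ T) {p q : Q} :
    quotientDist N mk T s p q = ⊥ ↔ p = q := by
  rw [← le_bot_iff, quotientDist_le_iff]
  simp only [le_bot_iff, WithBot.coe_ne_bot, false_or]
  refine or_iff_left ?_
  rintro ⟨t, ht, rfl, -⟩
  exact hT ht

theorem quotientDist_comm (p q : Q) : quotientDist N mk T s p q = quotientDist N mk T s q p := by
  refine eq_of_forall_ge_iff fun c => ?_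
  rw [quotientDist_le_iff, quotientDist_le_iff, eq_comm]
  refine or_congr_right (or_congr_right (exists_congr fun t => and_congr_right fun _ =>
    and_congr_right fun _ => ⟨?_, ?_⟩))
  · rintro ⟨x, y, hx, hy, h⟩
    exact ⟨y, x, hy, hx, N.d_comm x y ▸ h⟩
  · rintro ⟨x, y, hx, hy, h⟩
    exact ⟨y, x, hy, hx, N.d_comm x y ▸ h⟩

/-- Representatives of one class differ by an automorphism preserving all classes, so two pairs of
representatives can be made to share their middle point. -/
theorem quotientDist_le_max
    (hmk : ∀ x y, mk x = mk y → ∃ k : U → U, N.IsEmb N k ∧ (∀ z, mk (k z) = mk z) ∧ k y = x)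
    (p q r : Q) : quotientDist N mk T s p r ≤
      max (quotientDist N mk T s p q) (quotientDist N mk T s q r) := by
  have h1 := quotientDist_le_iff.1 (le_max_left (quotientDist N mk T s p q)
    (quotientDist N mk T s q r))
  have h2 := quotientDist_le_iff.1 (le_max_right (quotientDist N mk T s p q)
    (quotientDist N mk T s q r))
  rcases h1 with rfl | h1 | ⟨t, ht, htc, x, y, rfl, rfl, hxy⟩
  · exact le_max_right _ _
  · exact quotientDist_le_iff.2 (Or.inr (Or.inl h1))
  · rcases h2 with rfl | h2 | ⟨t', ht', htc', y', z, hy', rfl, hyz⟩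
    · exact le_max_left _ _
    · exact quotientDist_le_iff.2 (Or.inr (Or.inl h2))
    · obtain ⟨k, hk, hkmk, hky⟩ := hmk y y' hy'.symm
      refine quotientDist_le_iff.2 (Or.inr (Or.inr ⟨max t t', ?_, max_le htc htc', x, k z, rfl,
        hkmk z, N.d_le_of_le (hxy.trans (le_max_left _ _)) ?_⟩))
      · rcases max_choice t t' with h | h <;> rw [h] <;> assumption
      · rw [← hky, hk.d_eq]
        exact hyz.trans (le_max_right _ _)

theorem quotientDist_map_le {k : U → U} (hk : N.IsEmb N k) {σ : Q → Q}
    (hσ : ∀ x, σ (mk x) = mk (k x)) (p q : Q) :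
    quotientDist N mk T s (σ p) (σ q) ≤ quotientDist N mk T s p q := by
  rw [quotientDist_le_iff]
  rcases quotientDist_le_iff.1 (le_refl (quotientDist N mk T s p q)) with
    h | h | ⟨t, ht, htc, x, y, rfl, rfl, hxy⟩
  · exact Or.inl (congrArg σ h)
  · exact Or.inr (Or.inl h)
  · exact Or.inr (Or.inr ⟨t, ht, htc, k x, k y, (hσ x).symm, (hσ y).symm, (hk.d_eq x y).trans_le hxy⟩)

theorem quotientDist_mk_eq {x y : U}
    (hmk : ∀ x y, mk x = mk y → ∃ k : U → U, N.IsEmb N k ∧ (∀ z, mk (k z) = mk z) ∧ k y = x)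
    (hs : N.d x y ≤ s) (hT : x = y ∨ N.d x y ∈ T) (hxy : ∀ z, mk z = mk y → N.d x y ≤ N.d x z) :
    quotientDist N mk T s (mk x) (mk y) = N.d x y := by
  refine eq_of_forall_ge_iff fun c => ?_
  rw [quotientDist_le_iff]
  constructor
  · rintro (h | h | ⟨t, -, htc, x', y', hx', hy', h⟩)
    · exact (hxy x h).trans (by rw [N.d_self]; exact bot_le)
    · exact hs.trans h
    · obtain ⟨k, hk, hkmk, hkx⟩ := hmk x x' hx'.symm
      refine (hxy (k y') ((hkmk y').trans hy')).trans ?_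
      rw [← hkx, hk.d_eq]
      exact h.trans htc
  · intro h
    rcases hT with rfl | hT
    · exact Or.inl rfl
    · exact Or.inr (Or.inr ⟨_, hT, h, x, y, rfl, rfl, le_rfl⟩)

end Quotient

/-! ### Finite quotients of actions of finitely generated abelian groups -/

section Action

variable {D : RandomisedUltrametricData} {U Γ : Type*} [CommGroup Γ] [Group.FG Γ] [MulAction Γ U]

/-- By the ultrametric inequality, the γ with d(γy, y) < d(x, y) form a subgroup K. If some ay is
closer to x than y is, the elements with this property form the coset aK. It is not K itself, so
separability keeps it away from the m-th powers. -/
theorem exists_pow_dist_le {N : D.UltraStr U} (hΓ : ∀ γ : Γ, N.IsEmb N (γ • ·)) (x y : U) :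
    ∃ m : ℕ, 0 < m ∧ ∀ γ : Γ, N.d x y ≤ N.d x (γ ^ m • y) := by
  by_cases h : ∃ a : Γ, N.d x (a • y) < N.d x y
  · obtain ⟨a, ha⟩ := h
    have hd : ∀ (γ : Γ) (u v : U), N.d (γ • u) (γ • v) = N.d u v := fun γ => (hΓ γ).d_eq
    have hinv : ∀ γ : Γ, N.d (γ⁻¹ • y) y = N.d (γ • y) y := fun γ => by
      rw [← hd γ, smul_inv_smul, N.d_comm]
    let K : Subgroup Γ :=
      { carrier := {γ | N.d (γ • y) y < N.d x y}
        one_mem' := by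
          show N.d ((1 : Γ) • y) y < _
          rw [one_smul, N.d_self]
          exact bot_le.trans_lt ha
        mul_mem' := fun {γ δ} hγ hδ => by
          refine (N.d_le_max _ (γ • y) _).trans_lt (max_lt ?_ hγ)
          rw [mul_smul, hd]
          exact hδ
        inv_mem' := fun {γ} hγ => (hinv γ).trans_lt hγ }
    obtain ⟨m, hm, hK⟩ := K.exists_pow_notMem (a := a) fun haK =>
      lt_irrefl _ ((N.d_le_max x (a • y) y).trans_lt (max_lt ha haK))
    refine ⟨m, hm, fun γ => not_lt.1 fun hlt => hK γ ?_⟩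
    show N.d _ _ < _
    rw [← hd a, smul_smul, mul_inv_cancel_left]
    exact (N.d_le_max _ x _).trans_lt (max_lt (N.d_comm x _ ▸ hlt) ha)
  · push Not at h
    exact ⟨1, one_pos, fun γ => h _⟩

/-- Separability is applied in a power of Γ, to the tuples δ that act on x like a single element of
Γ. If y fails the relation, it is not a Γ-translate of x, so the δ with y = δx is outside this
subgroup. -/
theorem exists_pow_rel {N : D.UltraStr U} (hΓ : ∀ γ : Γ, N.IsEmb N (γ • ·)) {i : Fin D.r}
    {x y : Fin (D.arity i) → U} (hx : N.P i x) :
    ∃ m : ℕ, 0 < m ∧ ∀ (ν : Fin (D.arity i) → Γ) (γ : Γ),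
      (∀ j, y j = ν j ^ m • γ • x j) → N.P i y := by
  by_cases hy : N.P i y
  · exact ⟨1, one_pos, fun _ _ _ => hy⟩
  by_cases h : ∃ δ : Fin (D.arity i) → Γ, ∀ j, y j = δ j • x j
  · obtain ⟨δ, hδ⟩ := h
    let K : Subgroup (Fin (D.arity i) → Γ) :=
      { carrier := {δ | ∃ γ : Γ, ∀ j, δ j • x j = γ • x j}
        one_mem' := ⟨1, fun j => rfl⟩
        mul_mem' := by
          rintro δ δ' ⟨γ, h⟩ ⟨γ', h'⟩
          refine ⟨γ' * γ, fun j => ?_⟩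
          rw [Pi.mul_apply, mul_smul, h', smul_comm, h, mul_smul]
        inv_mem' := by
          rintro δ ⟨γ, h⟩
          refine ⟨γ⁻¹, fun j => ?_⟩
          rw [Pi.inv_apply, inv_smul_eq_iff, smul_comm, h, inv_smul_smul] }
    obtain ⟨m, hm, hK⟩ := K.exists_pow_notMem (a := δ) (by
      rintro ⟨γ, h⟩
      refine hy ?_
      have : y = (γ • ·) ∘ x := funext fun j => (hδ j).trans (h j)
      rw [this]
      exact ((hΓ γ).P_iff i x).2 hx)
    refine ⟨m, hm, fun ν γ hν => (hK ν ⟨γ⁻¹, fun j => ?_⟩).elim⟩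
    rw [Pi.mul_apply, Pi.inv_apply, Pi.pow_apply, mul_smul, inv_smul_eq_iff, smul_comm, ← hδ, hν,
      smul_comm, inv_smul_smul]
  · exact ⟨1, one_pos, fun ν γ hν => (h ⟨fun j => ν j ^ 1 * γ, fun j => by
      rw [hν, mul_smul]⟩).elim⟩

theorem exists_separating_exponent {N : D.UltraStr U} (hΓ : ∀ γ : Γ, N.IsEmb N (γ • ·))
    (F : Finset U) : ∃ m : ℕ, 0 < m ∧
      (∀ x ∈ F, ∀ y ∈ F, ∀ γ : Γ, N.d x y ≤ N.d x (γ ^ m • y)) ∧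
      ∀ i (x y : Fin (D.arity i) → U), (∀ j, x j ∈ F) → (∀ j, y j ∈ F) → N.P i x →
        ∀ (ν : Fin (D.arity i) → Γ) (γ : Γ), (∀ j, y j = ν j ^ m • γ • x j) → N.P i y := by
  obtain ⟨m, hm, h⟩ := exists_pos_forall_of_finite
    (p := fun (q : F × F) m => ∀ γ : Γ, N.d q.1 q.2 ≤ N.d q.1 (γ ^ m • (q.2 : U)))
    (fun q => exists_pow_dist_le hΓ _ _) (fun q m c h γ => by
      rw [mul_comm, pow_mul]; exact h _)
  obtain ⟨m', hm', h'⟩ := exists_pos_forall_of_finite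
    (p := fun (q : Σ i, (Fin (D.arity i) → F) × (Fin (D.arity i) → F)) m =>
      N.P q.1 (fun j => q.2.1 j) → ∀ (ν : Fin (D.arity q.1) → Γ) (γ : Γ),
        (∀ j, (q.2.2 j : U) = ν j ^ m • γ • (q.2.1 j : U)) → N.P q.1 fun j => q.2.2 j)
    (fun q => by
      by_cases hq : N.P q.1 (fun j => q.2.1 j)
      · obtain ⟨m, hm, h⟩ := exists_pow_rel hΓ (y := fun j => (q.2.2 j : U)) hq
        exact ⟨m, hm, fun _ => h⟩
      · exact ⟨1, one_pos, fun h => (hq h).elim⟩)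
    (fun q m c h hq ν γ hν => h hq (fun j => ν j ^ c) γ fun j => by
      rw [hν, mul_comm, pow_mul])
  refine ⟨m * m', Nat.mul_pos hm hm', fun x hx y hy γ => ?_, fun i x y hx hy hP ν γ hν => ?_⟩
  · rw [mul_comm, pow_mul]
    exact h (⟨x, hx⟩, ⟨y, hy⟩) _
  · refine h' ⟨i, fun j => ⟨x j, hx j⟩, fun j => ⟨y j, hy j⟩⟩ hP (fun j => ν j ^ m) γ fun j => ?_
    rw [← pow_mul]
    exact hν j

variable (U Γ) in
/-- The orbit relation of the subgroup of `m`-th powers. -/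
def powOrbitSetoid (m : ℕ) : Setoid U where
  r x y := ∃ γ : Γ, γ ^ m • x = y
  iseqv :=
    { refl := fun x => ⟨1, by simp⟩
      symm := by
        rintro x _ ⟨γ, rfl⟩
        exact ⟨γ⁻¹, by simp⟩
      trans := by
        rintro x _ _ ⟨γ, rfl⟩ ⟨δ, rfl⟩
        exact ⟨δ * γ, by rw [mul_pow, mul_smul]⟩ }

end Action

/-! ### Finite approximations from quotients by m-th powers -/

section FiniteQuotient

universe u

variable {D : RandomisedUltrametricData} {U : Type u} {Γ : Type*} [CommGroup Γ] [Group.FG Γ]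
  [MulAction Γ U]

/-- A finite part of an ultrametric structure with an action of a finitely generated abelian group
embeds, compatibly with the actions, into a finite ultrametric structure with an action. -/
theorem exists_finite_quotient {N : D.UltraStr U} (hΓ : ∀ γ : Γ, N.IsEmb N (γ • ·)) (F : Finset U) :
    ∃ (B : Type u) (_ : Finite B) (N' : D.UltraStr B) (ι : F → B) (σ : Γ → B → B),
      (N.comap (Subtype.val : F → U) Subtype.val_injective).IsEmb N' ι ∧
      (∀ γ, N'.IsEmb N' (σ γ)) ∧ (∀ γ δ b, σ γ (σ δ b) = σ δ (σ γ b)) ∧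
      ∀ γ (x y : F), γ • (x : U) = y → σ γ (ι x) = ι y := by
  classical
  obtain ⟨m, hm, hd, hP⟩ := exists_separating_exponent hΓ F
  let Q := Quotient (powOrbitSetoid U Γ m)
  let mk : U → Q := Quotient.mk _
  have hmk : ∀ {x y}, mk x = mk y ↔ ∃ γ : Γ, γ ^ m • x = y := fun {x y} => Quotient.eq
  have hmk_smul : ∀ (γ : Γ) {x y}, mk x = mk y → mk (γ • x) = mk (γ • y) := fun γ x y h => by
    obtain ⟨δ, rfl⟩ := hmk.1 h
    exact hmk.2 ⟨δ, smul_comm _ _ _⟩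
  let act : Γ → Q → Q := fun γ => Quotient.lift (fun x => mk (γ • x)) fun x y h =>
    hmk_smul γ (Quotient.sound h)
  have hact : ∀ γ x, act γ (mk x) = mk (γ • x) := fun γ x => rfl
  have hact_act : ∀ γ δ q, act γ (act δ q) = act (γ * δ) q := fun γ δ q => by
    obtain ⟨x, rfl⟩ := Quotient.exists_rep q
    exact congrArg mk (smul_smul γ δ x)
  have hact_one : ∀ q, act 1 q = q := fun q => by
    obtain ⟨x, rfl⟩ := Quotient.exists_rep q
    exact congrArg mk (one_smul Γ x)
  have hlift : ∀ x y, mk x = mk y →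
      ∃ k : U → U, N.IsEmb N k ∧ (∀ z, mk (k z) = mk z) ∧ k y = x := fun x y h => by
    obtain ⟨γ, hγ⟩ := hmk.1 h.symm
    exact ⟨_, hΓ (γ ^ m), fun z => (hmk.2 ⟨γ, rfl⟩).symm, hγ⟩
  have hinj : ∀ x ∈ F, ∀ y ∈ F, mk x = mk y → x = y := fun x hx y hy h => by
    obtain ⟨γ, rfl⟩ := hmk.1 h
    obtain ⟨δ, hδ⟩ := hmk.1 h.symm
    have := hd x hx _ hy δ
    rwa [hδ, N.d_self, le_bot_iff, N.d_eq_bot] at this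
  obtain ⟨s, hs⟩ := exists_dist_bound N (Subtype.val : F → U)
  -- Discarding `⊥` keeps distinct classes at a proper distance, even where representatives come
  -- arbitrarily close.
  let T := ((F ×ˢ F).image fun q => N.d q.1 q.2).erase ⊥
  let NQ : D.UltraStr Q :=
    { d := quotientDist N mk T s
      -- Only translates of related tuples from `F` are declared related: `m` is chosen to control
      -- those alone, and images of other related tuples might have repeated entries.
      P := fun i p => ∃ x : Fin (D.arity i) → U, (∀ j, x j ∈ F) ∧ N.P i x ∧
        ∃ γ : Γ, ∀ j, p j = mk (γ • x j)
      d_eq_bot := quotientDist_eq_bot_iff (Finset.notMem_erase _ _)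
      d_comm := quotientDist_comm
      d_le_max := quotientDist_le_max hlift
      P_comp := fun i τ hτ p => by
        constructor
        · rintro ⟨x, hx, hPx, γ, hγ⟩
          refine ⟨x ∘ τ.symm, fun j => hx _, (N.P_comp i τ hτ _).1 ?_, γ, fun j => ?_⟩
          · have : (x ∘ τ.symm) ∘ τ = x := funext fun j => by simp
            rwa [this]
          · simpa using hγ (τ.symm j)
        · rintro ⟨x, hx, hPx, γ, hγ⟩
          exact ⟨x ∘ τ, fun j => hx _, (N.P_comp i τ hτ _).2 hPx, γ, fun j => hγ _⟩
      P_injective := fun i p => by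
        rintro ⟨x, hx, hPx, γ, hγ⟩ j l hjl
        rw [hγ, hγ] at hjl
        have := hmk_smul γ⁻¹ hjl
        rw [inv_smul_smul, inv_smul_smul] at this
        exact N.P_injective i x hPx (hinj _ (hx j) _ (hx l) this) }
  have hactP : ∀ γ i p, NQ.P i p → NQ.P i (act γ ∘ p) := by
    rintro γ i p ⟨x, hx, hPx, δ, hδ⟩
    exact ⟨x, hx, hPx, γ * δ, fun j => by rw [Function.comp_apply, hδ, hact, mul_smul]⟩
  have hinv : ∀ γ q, act γ⁻¹ (act γ q) = q := fun γ q => by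
    rw [hact_act, inv_mul_cancel, hact_one]
  have hactE : ∀ γ, NQ.IsEmb NQ (act γ) := fun γ => by
    have hle : ∀ γ p q, NQ.d (act γ p) (act γ q) ≤ NQ.d p q := fun γ =>
      quotientDist_map_le (hΓ γ) (hact γ)
    refine ⟨fun p q => le_antisymm (hle γ p q) ?_, fun i p => ⟨fun h => ?_, hactP γ i p⟩⟩
    · have := hle γ⁻¹ (act γ p) (act γ q)
      rwa [hinv, hinv] at this
    · have := hactP γ⁻¹ i _ h
      rwa [show act γ⁻¹ ∘ act γ ∘ p = p from funext fun j => hinv γ _] at this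
  have hι : (N.comap (Subtype.val : F → U) Subtype.val_injective).IsEmb NQ fun x => mk x := by
    refine ⟨fun x y => quotientDist_mk_eq hlift (hs x y) ?_ fun z hz => ?_, fun i x => ⟨?_, fun h => ?_⟩⟩
    · by_cases hxy : (x : U) = y
      · exact Or.inl hxy
      · exact Or.inr (Finset.mem_erase.2 ⟨mt N.d_eq_bot.1 hxy,
          Finset.mem_image.2 ⟨(x, y), Finset.mem_product.2 ⟨x.2, y.2⟩, rfl⟩⟩)
    · obtain ⟨γ, rfl⟩ := hmk.1 hz.symm
      exact hd x x.2 y y.2 γ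
    · rintro ⟨y, hy, hPy, γ, hγ⟩
      choose ν hν using fun j => hmk.1 (hγ j).symm
      exact hP i y (fun j => x j) hy (fun j => (x j).2) hPy ν γ fun j => (hν j).symm
    · exact ⟨fun j => x j, fun j => (x j).2, h, 1, fun j => by rw [one_smul]; rfl⟩
  have hfin : Finite (Γ ⧸ (powMonoidHom (α := Γ) m).range) :=
    Subgroup.finiteIndex_iff_finite_quotient.1
      (Subgroup.finiteIndex_range_powMonoidHom_of_fg Γ hm.ne')
  -- The full quotient may be infinite. The saturation of the image of `F` is finite because Γ/Γ^m
  -- is.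
  let Bs : Set Q := {q | ∃ x ∈ F, ∃ γ : Γ, q = mk (γ • x)}
  have hBs : Bs.Finite := by
    refine (Set.finite_range fun c : F × (Γ ⧸ (powMonoidHom (α := Γ) m).range) =>
      mk (c.2.out • (c.1 : U))).subset ?_
    rintro _ ⟨x, hx, γ, rfl⟩
    refine ⟨(⟨x, hx⟩, (γ : Γ ⧸ (powMonoidHom (α := Γ) m).range)), ?_⟩
    obtain ⟨δ, hδ⟩ := QuotientGroup.eq.1 (Quotient.out_eq' (γ : Γ ⧸ (powMonoidHom (α := Γ) m).range))
    refine hmk.2 ⟨δ, ?_⟩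
    have h1 : δ ^ m = (γ : Γ ⧸ (powMonoidHom (α := Γ) m).range).out⁻¹ * γ := hδ
    rw [h1, smul_smul, mul_comm, mul_inv_cancel_left]
  have hBact : ∀ γ, ∀ q ∈ Bs, act γ q ∈ Bs := by
    rintro γ _ ⟨x, hx, δ, rfl⟩
    exact ⟨x, hx, γ * δ, by rw [hact, mul_smul]⟩
  have hval : ((NQ.comap (Subtype.val : Bs → Q) Subtype.val_injective).IsEmb NQ Subtype.val) :=
    NQ.isEmb_comap _ _
  refine ⟨Bs, hBs.to_subtype, NQ.comap Subtype.val Subtype.val_injective,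
    fun x => ⟨mk x, x, x.2, 1, by rw [one_smul]⟩, fun γ b => ⟨act γ b, hBact γ b b.2⟩,
    ⟨hι.d_eq, hι.P_iff⟩, fun γ => ⟨fun p q => (hactE γ).d_eq p q, fun i p => (hactE γ).P_iff i _⟩,
    fun γ δ b => Subtype.ext ?_, fun γ x y h => Subtype.ext ?_⟩
  · show act γ (act δ b) = act δ (act γ b)
    rw [hact_act, hact_act, mul_comm]
  · show act γ (mk x) = mk y
    rw [hact, h]

variable [Countable U] [D.language.Structure U]

theorem IsRandomisedUltrametricSpace.hasFiniteApproximations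
    (hU : D.IsRandomisedUltrametricSpace U) (n : ℕ) : HasFiniteApproximations D.language U n := by
  intro g hg X hX
  let Γ := Subgroup.closure (Set.range g)
  have : IsMulCommutative Γ := Subgroup.isMulCommutative_closure (by
    rintro _ ⟨i, rfl⟩ _ ⟨j, rfl⟩
    exact hg i j)
  let _ : CommGroup Γ := { (inferInstance : Group Γ) with mul_comm := mul_comm' }
  let _ : MulAction (U ≃[D.language] U) U :=
    { smul := fun f x => f x, one_smul := fun _ => rfl, mul_smul := fun _ _ _ => rfl }
  -- The images of `X` are included so that the action on the finite quotient records the values of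
  -- `g` on `X`.
  have hX' : (X ∪ ⋃ i, g i '' X).Finite := hX.union (Set.finite_iUnion fun i => hX.image _)
  have hmem : ∀ x, x ∈ hX'.toFinset ↔ x ∈ X ∪ ⋃ i, g i '' X := fun x => hX'.mem_toFinset
  obtain ⟨B, _, N, ι, σ, hι, hσ, hcomm, hσι⟩ := exists_finite_quotient (Γ := Γ) (N := hU.ultraStr)
    (fun γ => hU.isEmb γ.1) hX'.toFinset
  obtain ⟨φ, hφ, hφι⟩ := hU.exists_isEmb_extending hι
    (hU.ultraStr.isEmb_comap (Subtype.val : hX'.toFinset → U) Subtype.val_injective)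
  let γ : Fin n → Γ := fun i => ⟨g i, Subgroup.subset_closure ⟨i, rfl⟩⟩
  choose p hp using fun i => hU.exists_equiv_of_isEmb hφ (hσ (γ i))
  have hpart := isPartialCommutingTuple_range hp fun i j b => hcomm (γ i) (γ j) b
  obtain ⟨r, hr, hrp⟩ := hpart.exists_commutingTuple hU
  refine ⟨r, hr, fun i x hx => ?_, Set.range φ, hpart.finite, fun x hx => ?_, fun i x hx => ?_⟩
  · have hx₁ : x ∈ hX'.toFinset := (hmem x).2 (Or.inl hx)
    have hx₂ : g i x ∈ hX'.toFinset := (hmem _).2 (Or.inr (Set.mem_iUnion.2 ⟨i, x, hx, rfl⟩))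
    have h1 : φ (ι ⟨x, hx₁⟩) = x := hφι ⟨x, hx₁⟩
    have h2 : φ (ι ⟨g i x, hx₂⟩) = g i x := hφι ⟨g i x, hx₂⟩
    rw [hrp i x ⟨_, h1⟩, ← h2, ← hσι (γ i) ⟨x, hx₁⟩ ⟨g i x, hx₂⟩ rfl, ← hp, h1]
  · exact ⟨ι ⟨x, (hmem x).2 (Or.inl hx)⟩, hφι _⟩
  · rw [hrp i x hx]
    exact hpart.invariant i x hx

end FiniteQuotient

end RandomisedUltrametricData

theorem mainTheorem5 (D : RandomisedUltrametricData) (U : Type*) [Countable U]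
    [D.language.Structure U] (hU : D.IsRandomisedUltrametricSpace U) :
    (∀ n : ℕ, ∃ g : Fin n → (U ≃[D.language] U), IsGenericCommutingTuple g) ∧
    (∀ (n : ℕ) (g : Fin n → (U ≃[D.language] U)), IsGenericCommutingTuple g →
      {h : commutant g |
        IsGenericCommutingTuple (n := n + 1) (Fin.snoc g (h : U ≃[D.language] U))} ∈
          residual (commutant g) ∧
      ∃ h : commutant g, conjugatesOf h ∈ residual (commutant g)) := by
  have hiff : ∀ {n : ℕ} {g : Fin n → (U ≃[D.language] U)},
      IsGenericCommutingTuple g ↔ IsUniversalTuple g :=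
    isGenericCommutingTuple_iff (hU.hasFiniteApproximations _) (hU.hasTupleAmalgamation _)
  refine ⟨fun n => ?_, fun n g hg => ?_⟩
  · obtain ⟨g, hg⟩ := exists_isUniversalTuple (hU.hasFiniteApproximations n)
      (hU.hasTupleAmalgamation n)
    exact ⟨g, hiff.2 hg⟩
  · have hres := residual_commutant_isUniversalTuple (hU.hasFiniteApproximations (n + 1))
      (hU.hasTupleAmalgamation (n + 1)) (hiff.1 hg)
    simp only [hiff]
    exact ⟨hres, exists_conjugatesOf_mem_residual hres⟩
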